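/- Let $M$ be a compact smooth manifold without boundary, let $\Gamma(S^2T^*M)$ be the space of smooth symmetric $\binom02$-tensor fields and $\mathcal M(M)\subset\Gamma(S^2T^*M)$ the open cone of Riemannian metrics. A bilinear form $h$ is identified with $T M\to T^*M$, $X\mapsto h(X,\cdot)$, so that $h\,g^{-1}k$ and $\mathrm{Tr}(g^{-1}h)$ make sense; put $g^0_2(h,k)=\mathrm{Tr}(g^{-1}hg^{-1}k)$. For each $g\in\mathcal M(M)$ let $P_g:\Gamma(S^2T^*M)\to\Gamma(S^2T^*M)$ be a linear bijective operator that is symmetric and positive with respect to $\int_M g^0_2(\cdot,\cdot)\,\mathrm{vol}(g)$, and suppose that $(g,h)\mapsto P_gh$ is smooth (smooth finite-dimensional families are mapped to smooth families). (Positive symmetric bijective pseudo-differential operators depending smoothly on $g$ are an example.) Put $$G^P_g(h,k)=\int_M g^0_2(P_gh,k)\,\mathrm{vol}(g),\qquad (D_{(g,m)}P)h=\partial_s|_{0}P_{g+sm}h .$$ The derivative $(D_{(g,m)}P)h\in\Gamma(S^2T^*M)$ exists, and the following hold. (a) There is exactly one family $K_g(h,m)\in\Gamma(S^2T^*M)$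 with $D_{(g,m)}G^P_g(h,k)=G^P_g(K_g(h,m),k)$ for all $g\in\mathcal M(M)$ and $h,k,m\in\Gamma(S^2T^*M)$ (where $D_{(g,m)}G^P_g(h,k)=\partial_s|_0G^P_{g+sm}(h,k)$). It is bilinear in $(h,m)$ and $$K_g(h,m)=P_g^{-1}\Big[-m g^{-1}P_gh+(D_{(g,m)}P)h-P_gh\,g^{-1}m+\tfrac12\mathrm{Tr}(g^{-1}m)P_gh\Big].$$ It is smooth in $(g,h,m)$ if $(g,h)\mapsto P_g^{-1}h$ is smooth. (b) Assume that there is an adjoint $(D_{(g,\cdot)}Ph)^*(k)\in\Gamma(S^2T^*M)$, smooth in $(g,h,k)$ and bilinear in $(h,k)$, with $$\int_M g^0_2\big((D_{(g,m)}P)h,k\big)\mathrm{vol}(g)=\int_M g^0_2\big(m,(D_{(g,\cdot)}Ph)^*(k)\big)\mathrm{vol}(g)\quad\text{for all } g,m,h,k.$$ Then there is exactly one family $H_g(h,k)\in\Gamma(S^2T^*M)$ with $D_{(g,m)}G^P_g(h,k)=G^P_g(m,H_g(h,k))$ for all $g,m,h,k$. It is bilinear in $(h,k)$ and $$H_g(h,k)=P_g^{-1}\Big[(D_{(g,\cdot)}Ph)^*(k)-P_gh\,g^{-1}k-k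 g^{-1}P_gh+\tfrac12\,g\,\mathrm{Tr}(g^{-1}P_gh\,g^{-1}k)\Big].$$ It is smooth in $(g,h,k)$ if $(g,h)\mapsto P_g^{-1}h$ is smooth. (c) Under the assumption of (b), let $t\mapsto g(t)\in\mathcal M(M)$ be a smooth curve on an open set $J\subset\mathbb R$ of times. Then $(Pg_t)_t$ exists and $(Pg_t)_t=(D_{(g,g_t)}P)g_t+Pg_{tt}$, and the following are equivalent: 1. $g$ is a geodesic of $G^P$, that is, for every $[a,b]\subset J$ with $a<b$ it is a critical point of the energy $\tfrac12\int_a^bG^P_g(g_t,g_t)\,dt$ among smooth variations through curves in $\mathcal M(M)$ with fixed end points; 2. $g_{tt}=\tfrac12H_g(g_t,g_t)-K_g(g_t,g_t)$ on $J$; 3. on $J$, $$g_{tt}=P^{-1}\Big[\tfrac12(D_{(g,\cdot)}Pg_t)^*(g_t)+\tfrac14\,g\,\mathrm{Tr}(g^{-1}Pg_t\,g^{-1}g_t)+\tfrac12g_tg^{-1}Pg_t+\tfrac12Pg_t\,g^{-1}g_t-(D_{(g,g_t)}P)g_t-\tfrac12\mathrm{Tr}(g^{-1}g_t)Pg_t\Big];$$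 4. on $J$, $$(Pg_t)_t=\tfrac12(D_{(g,\cdot)}Pg_t)^*(g_t)+\tfrac14\,g\,\mathrm{Tr}(g^{-1}Pg_t\,g^{-1}g_t)+\tfrac12g_tg^{-1}Pg_t+\tfrac12Pg_t\,g^{-1}g_t-\tfrac12\mathrm{Tr}(g^{-1}g_t)Pg_t .$$ -/

import Mathlib

open scoped Manifold ContDiff Topology
open Set

noncomputable section

namespace MetricSpaceOfMetrics

variable {n : ℕ} {M : Type*} [TopologicalSpace M] [ChartedSpace (EuclideanSpace ℝ (Fin n)) M]

/-! ### Pointwise linear algebra -/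

/-- Bilinear forms on the tangent space at `x`.  A form `h` is identified with the map
`T_x M → T_x^* M`, `X ↦ h(X, ·)`. -/
abbrev TangentForm (x : M) : Type :=
  TangentSpace (𝓡 n) x →L[ℝ] TangentSpace (𝓡 n) x →L[ℝ] ℝ

/-- The inverse `g⁻¹ : T_x^* M → T_x M` of `g : T_x M → T_x^* M`. -/
def sharp {x : M} (g : TangentForm (n := n) x) :
    (TangentSpace (𝓡 n) x →L[ℝ] ℝ) →L[ℝ] TangentSpace (𝓡 n) x :=
  ContinuousLinearMap.inverse g

/-- The composition `h.g⁻¹.k : T_x M → T_x^* M`. -/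
def sandwich {x : M} (g h k : TangentForm (n := n) x) : TangentForm (n := n) x :=
  h.comp ((sharp g).comp k)

/-- The trace `Tr(g⁻¹.h)`. -/
def traceForm {x : M} (g h : TangentForm (n := n) x) : ℝ :=
  LinearMap.trace ℝ (TangentSpace (𝓡 n) x) (((sharp g).comp h : _ →L[ℝ] _) : _ →ₗ[ℝ] _)

/-- The induced metric `g⁰₂(h, k) = Tr(g⁻¹.h.g⁻¹.k)` on symmetric bilinear forms. -/
def g02 {x : M} (g h k : TangentForm (n := n) x) : ℝ :=
  traceForm g (sandwich g h k)

/-! ### Symmetric tensor fields and Riemannian metrics -/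

variable [IsManifold (𝓡 n) ∞ M]

variable (n M) in
/-- The symmetric tensor fields as a subspace of the smooth sections of `T*M ⊗ T*M`. -/
def symTensorSubmodule : Submodule ℝ
    (ContMDiffSection (𝓡 n)
      (EuclideanSpace ℝ (Fin n) →L[ℝ] EuclideanSpace ℝ (Fin n) →L[ℝ] ℝ) ∞
      (fun x : M => TangentSpace (𝓡 n) x →L[ℝ] TangentSpace (𝓡 n) x →L[ℝ] ℝ)) where
  carrier := {h | ∀ (x : M) (X Y : TangentSpace (𝓡 n) x), h x X Y = h x Y X}
  add_mem' := by
    intro a b ha hb x X Y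
    simp only [ContMDiffSection.coe_add, Pi.add_apply, add_apply]
    rw [ha x X Y, hb x X Y]
  zero_mem' := by
    intro x X Y
    simp
  smul_mem' := by
    intro c a ha x X Y
    simp only [ContMDiffSection.coe_smul, Pi.smul_apply, smul_apply]
    rw [ha x X Y]

variable (n M) in
/-- The space `Γ(S²T*M)` of smooth symmetric `(0,2)`-tensor fields on `M`. -/
def SymTensor : Type _ := symTensorSubmodule n M

instance : AddCommGroup (SymTensor n M) := inferInstanceAs (AddCommGroup (symTensorSubmodule n M))

instance : Module ℝ (SymTensor n M) := inferInstanceAs (Module ℝ (symTensorSubmodule n M))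

/-- The value of a symmetric tensor field at a point. -/
def SymTensor.eval (h : SymTensor n M) (x : M) : TangentForm (n := n) x := h.1 x

instance : CoeFun (SymTensor n M) (fun _ => ∀ x : M, TangentForm (n := n) x) := ⟨SymTensor.eval⟩

/-- `g ∈ Γ(S²₊T*M)`: the symmetric tensor field `g` is a Riemannian metric. -/
def IsMetric (g : SymTensor n M) : Prop :=
  ∀ (x : M) (X : TangentSpace (𝓡 n) x), X ≠ 0 → 0 < g x X X

/-! ### Calculus in the space of symmetric tensor fields -/

/-- The family `c` of symmetric tensor fields, with parameters in the subset `U` of a vector space,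
is smooth: `(u, x) ↦ c u x` is smooth on `U × M`. -/
def IsSmoothFamily {W : Type*} [NormedAddCommGroup W] [NormedSpace ℝ W]
    (U : Set W) (c : W → SymTensor n M) : Prop :=
  ContMDiffOn (𝓘(ℝ, W).prod (𝓡 n))
    ((𝓡 n).prod 𝓘(ℝ, EuclideanSpace ℝ (Fin n) →L[ℝ] EuclideanSpace ℝ (Fin n) →L[ℝ] ℝ)) ∞
    (fun p : W × M => Bundle.TotalSpace.mk'
      (EuclideanSpace ℝ (Fin n) →L[ℝ] EuclideanSpace ℝ (Fin n) →L[ℝ] ℝ)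
      (E := fun x : M => TangentSpace (𝓡 n) x →L[ℝ] TangentSpace (𝓡 n) x →L[ℝ] ℝ)
      p.2 (c p.1 p.2))
    (U ×ˢ univ)

/-- `F g h` depends smoothly on the metric `g` and on `h`, in the sense of calculus in the
infinite-dimensional space `Γ(S²T*M)`: smooth finite-dimensional families of arguments are mapped
to smooth families. -/
def IsSmooth₂ (F : SymTensor n M → SymTensor n M → SymTensor n M) : Prop :=
  ∀ (W : Type) [NormedAddCommGroup W] [NormedSpace ℝ W] [FiniteDimensional ℝ W] (U : Set W),
    IsOpen U → ∀ g h : W → SymTensor n M, (∀ u ∈ U, IsMetric (g u)) →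
      IsSmoothFamily U g → IsSmoothFamily U h → IsSmoothFamily U (fun u => F (g u) (h u))

/-- `F g h k` depends smoothly on the metric `g` and on `h`, `k`. -/
def IsSmooth₃ (F : SymTensor n M → SymTensor n M → SymTensor n M → SymTensor n M) : Prop :=
  ∀ (W : Type) [NormedAddCommGroup W] [NormedSpace ℝ W] [FiniteDimensional ℝ W] (U : Set W),
    IsOpen U → ∀ g h k : W → SymTensor n M, (∀ u ∈ U, IsMetric (g u)) →
      IsSmoothFamily U g → IsSmoothFamily U h → IsSmoothFamily U k →
        IsSmoothFamily U (fun u => F (g u) (h u) (k u))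

/-- `F g h k` is bilinear in `(h, k)` for each metric `g`. -/
def IsBilinear (F : SymTensor n M → SymTensor n M → SymTensor n M → SymTensor n M) : Prop :=
  ∀ g, IsMetric g →
    (∀ h, IsLinearMap ℝ (fun k => F g h k)) ∧ (∀ k, IsLinearMap ℝ (fun h => F g h k))

/-- The curve `c` of tensor fields has derivative `v` at `t` (pointwise on `M`). -/
def HasTensorDerivAt (c : ℝ → SymTensor n M) (v : SymTensor n M) (t : ℝ) : Prop :=
  ∀ (x : M) (X Y : TangentSpace (𝓡 n) x),
    HasDerivAt (fun τ => c τ x X Y) (v x X Y) t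

open Classical in
/-- The derivative `c_t(t)` of a curve of symmetric tensor fields. -/
def tensorDeriv (c : ℝ → SymTensor n M) (t : ℝ) : SymTensor n M :=
  if h : ∃ v, HasTensorDerivAt c v t then h.choose else 0

/-! ### Integration against the Riemannian volume density -/

/-- The density `√(det g(∂ᵢ, ∂ⱼ))` of `vol(g)` in the coordinates `y` of the chart at `p`. -/
def localDensity (g : SymTensor n M) (p : M) (y : EuclideanSpace ℝ (Fin n)) : ℝ :=
  let ψ := (extChartAt (𝓡 n) p).symm
  let frame : Fin n → TangentSpace (𝓡 n) (ψ y) := fun i =>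
    mfderiv 𝓘(ℝ, EuclideanSpace ℝ (Fin n)) (𝓡 n) ψ y (EuclideanSpace.single i (1 : ℝ))
  Real.sqrt (Matrix.det (Matrix.of fun i j => g (ψ y) (frame i) (frame j)))

section Integration

variable [T2Space M] [CompactSpace M]

variable (n M) in
theorem exists_chart_partition :
    ∃ ρ : SmoothPartitionOfUnity M (𝓡 n) M univ,
      ρ.IsSubordinate (fun p : M => (chartAt (EuclideanSpace ℝ (Fin n)) p).source) :=
  SmoothPartitionOfUnity.exists_isSubordinate (𝓡 n) isClosed_univ _
    (fun p => (chartAt (EuclideanSpace ℝ (Fin n)) p).open_source)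
    (fun p _ => mem_iUnion.2 ⟨p, mem_chart_source _ p⟩)

variable (n M) in
/-- A smooth partition of unity subordinate to the covering by chart domains. -/
def chartPartition : SmoothPartitionOfUnity M (𝓡 n) M univ :=
  (exists_chart_partition n M).choose

/-- The integral `∫_M f vol(g)`: the function is cut into pieces by a partition of unity subordinate
to the charts, and each piece is integrated in its chart against `√(det gᵢⱼ) dy`.  By the change of
variables formula the value does not depend on the partition of unity. -/
def volIntegral (g : SymTensor n M) (f : M → ℝ) : ℝ :=
  ∑ᶠ p : M, ∫ y in (extChartAt (𝓡 n) p).target,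
    chartPartition n M p ((extChartAt (𝓡 n) p).symm y) * f ((extChartAt (𝓡 n) p).symm y)
      * localDensity g p y

/-- The `L²` product `∫_M g⁰₂(h, k) vol(g)` of tensor fields. -/
def tensorL2 (g h k : SymTensor n M) : ℝ :=
  volIntegral g (fun x => g02 (g x) (h x) (k x))

/-! ### The metric `G^P` -/

/-- `P_g : Γ(S²T*M) → Γ(S²T*M)` is, for each Riemannian metric `g`, linear, symmetric and positive
with respect to the `L²` product, and bijective; and it depends smoothly on `g`. -/
structure IsMetricOperator (P : SymTensor n M → SymTensor n M →ₗ[ℝ] SymTensor n M) : Prop where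
  symm : ∀ g, IsMetric g → ∀ h k, tensorL2 g (P g h) k = tensorL2 g h (P g k)
  pos : ∀ g, IsMetric g → ∀ h, h ≠ 0 → 0 < tensorL2 g (P g h) h
  bij : ∀ g, IsMetric g → Function.Bijective (P g)
  smooth : IsSmooth₂ (fun g h => P g h)

/-- `G^P_g(h, k) = ∫_M g⁰₂(P_g h, k) vol(g)`. -/
def GP (P : SymTensor n M → SymTensor n M →ₗ[ℝ] SymTensor n M) (g h k : SymTensor n M) : ℝ :=
  tensorL2 g (P g h) k

/-- The directional derivative `(D_{(g,m)}P)h = ∂_s|₀ P_{g+sm} h`. -/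
def derivP (P : SymTensor n M → SymTensor n M →ₗ[ℝ] SymTensor n M) (g m h : SymTensor n M) :
    SymTensor n M :=
  tensorDeriv (fun s => P (g + s • m) h) 0

/-- `A g h k = (D_{(g,·)}P h)^*(k)` is an adjoint of the derivative of `P`:
`∫ g⁰₂((D_{(g,m)}P)h, k) vol(g) = ∫ g⁰₂(m, A g h k) vol(g)`, smooth in `(g, h, k)` and bilinear in
`(h, k)`. -/
structure IsDerivAdjoint (P : SymTensor n M → SymTensor n M →ₗ[ℝ] SymTensor n M)
    (A : SymTensor n M → SymTensor n M → SymTensor n M → SymTensor n M) : Prop where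
  adjoint : ∀ g, IsMetric g → ∀ m h k,
    tensorL2 g (derivP P g m h) k = tensorL2 g m (A g h k)
  smooth : IsSmooth₃ A
  bilin : IsBilinear A

/-- `K` is the first metric gradient: `D_{(g,m)}G^P_g(h, k) = G^P_g(K_g(h, m), k)`. -/
def IsGradientK (P : SymTensor n M → SymTensor n M →ₗ[ℝ] SymTensor n M)
    (K : SymTensor n M → SymTensor n M → SymTensor n M → SymTensor n M) : Prop :=
  ∀ g, IsMetric g → ∀ m h k,
    HasDerivAt (fun s : ℝ => GP P (g + s • m) h k) (GP P g (K g h m) k) 0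

/-- `H` is the second metric gradient: `D_{(g,m)}G^P_g(h, k) = G^P_g(m, H_g(h, k))`. -/
def IsGradientH (P : SymTensor n M → SymTensor n M →ₗ[ℝ] SymTensor n M)
    (H : SymTensor n M → SymTensor n M → SymTensor n M → SymTensor n M) : Prop :=
  ∀ g, IsMetric g → ∀ m h k,
    HasDerivAt (fun s : ℝ => GP P (g + s • m) h k) (GP P g m (H g h k)) 0

/-- The energy `½ ∫_a^b G^P_c(c_t, c_t) dt` of a curve of metrics. -/
def energy (P : SymTensor n M → SymTensor n M →ₗ[ℝ] SymTensor n M) (a b : ℝ)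
    (c : ℝ → SymTensor n M) : ℝ :=
  1 / 2 * ∫ t in a..b, GP P (c t) (tensorDeriv c t) (tensorDeriv c t)

/-- The curve `c` of metrics, defined on the open set `J` of times, is a geodesic of `G^P`: on each
compact interval in `J` it is a critical point of the energy among the smooth variations through
curves of metrics with fixed end points. -/
def IsGeodesicOn (P : SymTensor n M → SymTensor n M →ₗ[ℝ] SymTensor n M) (J : Set ℝ)
    (c : ℝ → SymTensor n M) : Prop :=
  ∀ a b : ℝ, a < b → Icc a b ⊆ J → ∀ (ε : ℝ), 0 < ε → ∀ w : ℝ → ℝ → SymTensor n M,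
    IsSmoothFamily (Ioo (-ε) ε ×ˢ J) (fun p : ℝ × ℝ => w p.1 p.2) →
    (∀ s ∈ Ioo (-ε) ε, ∀ t ∈ J, IsMetric (w s t)) →
    (∀ t ∈ J, w 0 t = c t) →
    (∀ s ∈ Ioo (-ε) ε, w s a = c a ∧ w s b = c b) →
    HasDerivAt (fun s => energy P a b (w s)) 0 0

end Integration

end MetricSpaceOfMetrics

end

/-!
Everything is reduced to calculus in charts.  A symmetric tensor field is represented in the chart
at `p` by a function with values in the bilinear forms on `ℝⁿ` (`SymTensor.rep`), and a family of
tensor fields is smooth if and only if these coordinates are smooth in the parameter and the point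
together (`isSmoothFamily_iff_rep`).  Hence smooth families can be differentiated in the parameter
and the derivatives are again smooth families (`IsSmoothFamily.dirDeriv`).

The `L²` product is a finite sum of integrals over compact subsets of the charts
(`tensorL2_eq_sum`), so it can be differentiated under the integral sign.  Its integrand
`√(det g) Tr(g⁻¹ h g⁻¹ k)` changes with `g` in the direction `m` by the pairing of
`metricVar g m h = -m g⁻¹ h - h g⁻¹ m + ½ Tr(g⁻¹ m) h` with `k` (`hasDerivAt_tensorL2`), and
`m ↦ metricVar g m h` has the adjoint `k ↦ metricVarAdj g h k` with respect to the `L²` product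
(`tensorL2_metricVar`).  The operator `P` is only assumed to map smooth finite-dimensional families
to smooth families; writing a curve as `c(t + s) = c(t) + s r(s)` with `r` smooth
(`exists_hadamard`) turns this into the chain rule
`(P_c h)_t = (D_{(c, c_t)} P) h + P_c h_t` (`IsMetricOperator.hasTensorDerivAt_comp`).

Together this gives the derivative of `G^P` in the direction `m` as the `L²` product of
`gradKForm P g h m` with `k`, or of `m` with `gradHForm P A g h k`.  The `L²` product is
nondegenerate, since `P` is positive and surjective, and this yields the existence, the uniqueness
and the formulas of the two gradients (`IsMetricOperator.isGradientK_iff`,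
`IsMetricOperator.isGradientH_iff`).

For the geodesic equation, the energy of a variation `w` is differentiated under the integral sign,
the partial derivatives of `w` are exchanged, and the term with `w_st` is removed by integration by
parts.  What remains is the integral of the `L²` product of `w_s` with the residual
`P(½ H(c_t, c_t) - K(c_t, c_t) - c_tt)` (`IsMetricOperator.hasDerivAt_energy_zero`).  If the
residual is not zero at a time `t₀`, then the variation `c + s χ e`, with `P e` equal to the
residual at `t₀` and with a bump function `χ` in time supported near `t₀`, has a nonzero derivative
of the energy, by the positivity of `P` (`IsMetricOperator.residual_eq_zero`).
-/

noncomputable section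

namespace MetricSpaceOfMetrics

/-! ### Auxiliary instances -/

local instance {n : ℕ} {M : Type*} [TopologicalSpace M]
    [ChartedSpace (EuclideanSpace ℝ (Fin n)) M] (x : M) :
    FiniteDimensional ℝ (TangentSpace (𝓡 n) x) :=
  inferInstanceAs (FiniteDimensional ℝ (EuclideanSpace ℝ (Fin n)))

local instance {n : ℕ} {M : Type*} [TopologicalSpace M]
    [ChartedSpace (EuclideanSpace ℝ (Fin n)) M] (x : M) : T2Space (TangentSpace (𝓡 n) x) :=
  inferInstanceAs (T2Space (EuclideanSpace ℝ (Fin n)))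

local instance {n : ℕ} {M : Type*} [TopologicalSpace M]
    [ChartedSpace (EuclideanSpace ℝ (Fin n)) M] [IsManifold (𝓡 n) ∞ M] : IsManifold (𝓡 n) 1 M :=
  IsManifold.of_le (n := ∞) (by simp)

-- The remaining instances are shortcuts, because the general search for them is slow.

local instance {n : ℕ} {M : Type*} [TopologicalSpace M]
    [ChartedSpace (EuclideanSpace ℝ (Fin n)) M] (x : M) :
    ContinuousAdd (TangentSpace (𝓡 n) x →L[ℝ] ℝ) := inferInstance

local instance {n : ℕ} {M : Type*} [TopologicalSpace M]
    [ChartedSpace (EuclideanSpace ℝ (Fin n)) M] (x : M) :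
    ContinuousSMul ℝ (TangentSpace (𝓡 n) x →L[ℝ] ℝ) := inferInstance

local instance {n : ℕ} : NormedSpace ℝ
    (EuclideanSpace ℝ (Fin n) →L[ℝ] EuclideanSpace ℝ (Fin n) →L[ℝ] ℝ) := inferInstance

local instance {n : ℕ} : ContinuousSMul ℝ (EuclideanSpace ℝ (Fin n)) := inferInstance

local instance {n : ℕ} : ContinuousSMul ℝ (EuclideanSpace ℝ (Fin n) →L[ℝ] ℝ) := inferInstance

local instance {n : ℕ} : ContinuousSMul ℝ
    (EuclideanSpace ℝ (Fin n) →L[ℝ] EuclideanSpace ℝ (Fin n) →L[ℝ] ℝ) := inferInstance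

/-! ### Linear algebra of bilinear forms -/

section LinearAlgebra

variable {V V' : Type*}
  [AddCommGroup V] [Module ℝ V] [TopologicalSpace V] [IsTopologicalAddGroup V] [ContinuousSMul ℝ V]
  [AddCommGroup V'] [Module ℝ V'] [TopologicalSpace V'] [IsTopologicalAddGroup V']
  [ContinuousSMul ℝ V']

/-- Bilinear forms on a topological vector space `V`, as maps from `V` to its dual. -/
abbrev BilForm (V : Type*) [AddCommGroup V] [Module ℝ V] [TopologicalSpace V]
    [IsTopologicalAddGroup V] [ContinuousSMul ℝ V] : Type _ := V →L[ℝ] V →L[ℝ] ℝ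

/-- `h g⁻¹ k`. -/
def sandwichB (g h k : BilForm V) : BilForm V :=
  h.comp ((ContinuousLinearMap.inverse g).comp k)

/-- `Tr(g⁻¹ h)`. -/
def traceB (g h : BilForm V) : ℝ :=
  LinearMap.trace ℝ V (((ContinuousLinearMap.inverse g).comp h : V →L[ℝ] V) : V →ₗ[ℝ] V)

/-- `Tr(g⁻¹ h g⁻¹ k)`. -/
def g02B (g h k : BilForm V) : ℝ := traceB g (sandwichB g h k)

/-- The pull-back `T^* h T` of a bilinear form along a linear map. -/
def pullB (T : V' →L[ℝ] V) (h : BilForm V) : BilForm V' :=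
  (ContinuousLinearMap.precomp ℝ T).comp (h.comp T)

@[simp] lemma pullB_apply (T : V' →L[ℝ] V) (h : BilForm V) (u v : V') :
    pullB T h u v = h (T u) (T v) := rfl

lemma pullB_add (T : V' →L[ℝ] V) (h k : BilForm V) :
    pullB T (h + k) = pullB T h + pullB T k := by ext; simp

lemma pullB_smul (T : V' →L[ℝ] V) (r : ℝ) (h : BilForm V) :
    pullB T (r • h) = r • pullB T h := by ext; simp

lemma inverse_comp_self {g : BilForm V} (hg : g.IsInvertible) (u : V) :
    ContinuousLinearMap.inverse g (g u) = u := by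
  obtain ⟨e, rfl⟩ := hg; simp

lemma self_comp_inverse {g : BilForm V} (hg : g.IsInvertible) (u : V →L[ℝ] ℝ) :
    g (ContinuousLinearMap.inverse g u) = u := by
  obtain ⟨e, rfl⟩ := hg; simp

lemma inverse_pullB (T : V' ≃L[ℝ] V) {g : BilForm V} (hg : g.IsInvertible) :
    ContinuousLinearMap.inverse (pullB (T : V' →L[ℝ] V) g) =
      (T.symm : V →L[ℝ] V').comp ((ContinuousLinearMap.inverse g).comp
        (ContinuousLinearMap.precomp ℝ (T.symm : V →L[ℝ] V'))) := by
  apply ContinuousLinearMap.inverse_eq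
  · ext u v
    simp [self_comp_inverse hg]
  · ext u
    simp only [ContinuousLinearMap.comp_apply, ContinuousLinearMap.id_apply]
    have : ContinuousLinearMap.precomp ℝ (T.symm : V →L[ℝ] V') (pullB (T : V' →L[ℝ] V) g u)
        = g (T u) := by ext; simp
    rw [this, inverse_comp_self hg]; simp

lemma sandwichB_pullB (T : V' ≃L[ℝ] V) {g : BilForm V} (hg : g.IsInvertible) (h k : BilForm V) :
    sandwichB (pullB (T : V' →L[ℝ] V) g) (pullB (T : V' →L[ℝ] V) h) (pullB (T : V' →L[ℝ] V) k) =
      pullB (T : V' →L[ℝ] V) (sandwichB g h k) := by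
  ext u v
  simp only [sandwichB, inverse_pullB T hg, ContinuousLinearMap.comp_apply, pullB_apply]
  have : ContinuousLinearMap.precomp ℝ (T.symm : V →L[ℝ] V') (pullB (T : V' →L[ℝ] V) k u)
        = k (T u) := by ext; simp
  simp [this]

lemma traceB_pullB (T : V' ≃L[ℝ] V) {g : BilForm V} (hg : g.IsInvertible) (h : BilForm V) :
    traceB (pullB (T : V' →L[ℝ] V) g) (pullB (T : V' →L[ℝ] V) h) = traceB g h := by
  unfold traceB
  rw [← LinearMap.trace_conj' _ T.symm.toLinearEquiv]
  congr 1
  ext u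
  simp only [inverse_pullB T hg]
  have : ContinuousLinearMap.precomp ℝ (T.symm : V →L[ℝ] V') (pullB (T : V' →L[ℝ] V) h u)
        = h (T u) := by ext; simp
  simp [this, LinearEquiv.conj_apply]

lemma g02B_pullB (T : V' ≃L[ℝ] V) {g : BilForm V} (hg : g.IsInvertible) (h k : BilForm V) :
    g02B (pullB (T : V' →L[ℝ] V) g) (pullB (T : V' →L[ℝ] V) h) (pullB (T : V' →L[ℝ] V) k) =
      g02B g h k := by
  rw [g02B, sandwichB_pullB T hg, traceB_pullB T hg, g02B]

lemma traceB_add (g h k : BilForm V) : traceB g (h + k) = traceB g h + traceB g k := by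
  simp [traceB, ContinuousLinearMap.comp_add]

lemma traceB_smul (g : BilForm V) (r : ℝ) (h : BilForm V) :
    traceB g (r • h) = r * traceB g h := by
  simp [traceB]

lemma sandwichB_add_left (g h h' k : BilForm V) :
    sandwichB g (h + h') k = sandwichB g h k + sandwichB g h' k := by
  simp [sandwichB, ContinuousLinearMap.add_comp]

lemma sandwichB_add_right (g h k k' : BilForm V) :
    sandwichB g h (k + k') = sandwichB g h k + sandwichB g h k' := by
  simp [sandwichB, ContinuousLinearMap.comp_add]

lemma sandwichB_smul_left (g : BilForm V) (r : ℝ) (h k : BilForm V) :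
    sandwichB g (r • h) k = r • sandwichB g h k := by
  simp [sandwichB, ContinuousLinearMap.smul_comp]

lemma sandwichB_smul_right (g : BilForm V) (r : ℝ) (h k : BilForm V) :
    sandwichB g h (r • k) = r • sandwichB g h k := by
  simp [sandwichB]

lemma sandwichB_self_right {g : BilForm V} (hg : g.IsInvertible) (h : BilForm V) :
    sandwichB g h g = h := by
  ext u v
  simp [sandwichB, inverse_comp_self hg]

lemma sandwichB_assoc (g a b c : BilForm V) :
    sandwichB g (sandwichB g a b) c = sandwichB g a (sandwichB g b c) := rfl

/-- `Tr(g⁻¹ h g⁻¹ k)` is symmetric, by cyclicity of the trace; the forms need not be symmetric. -/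
lemma g02B_comm (g h k : BilForm V) : g02B g h k = g02B g k h := by
  unfold g02B traceB sandwichB
  exact LinearMap.trace_mul_comm ℝ
    (((ContinuousLinearMap.inverse g).comp h : V →L[ℝ] V) : V →ₗ[ℝ] V)
    (((ContinuousLinearMap.inverse g).comp k : V →L[ℝ] V) : V →ₗ[ℝ] V)

lemma g02B_add_left (g h h' k : BilForm V) :
    g02B g (h + h') k = g02B g h k + g02B g h' k := by
  rw [g02B, sandwichB_add_left, traceB_add, g02B, g02B]

lemma g02B_smul_left (g : BilForm V) (r : ℝ) (h k : BilForm V) :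
    g02B g (r • h) k = r * g02B g h k := by
  rw [g02B, sandwichB_smul_left, traceB_smul, g02B]

lemma g02B_add_right (g h k k' : BilForm V) :
    g02B g h (k + k') = g02B g h k + g02B g h k' := by
  rw [g02B, sandwichB_add_right, traceB_add, g02B, g02B]

lemma g02B_smul_right (g : BilForm V) (r : ℝ) (h k : BilForm V) :
    g02B g h (r • k) = r * g02B g h k := by
  rw [g02B, sandwichB_smul_right, traceB_smul, g02B]

/-- The form `-m g⁻¹ h - h g⁻¹ m + ½ Tr(g⁻¹ m) h`: pairing it with `k` gives the derivative of
`g ↦ g⁰₂(h, k) vol(g)` in the direction `m`. -/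
def metricVarB (g m h : BilForm V) : BilForm V :=
  (-1 : ℝ) • (sandwichB g m h + sandwichB g h m) + (1 / 2 * traceB g m) • h

/-- The form `-h g⁻¹ k - k g⁻¹ h + ½ g⁰₂(h, k) g`, the adjoint of `m ↦ metricVarB g m h`. -/
def metricVarAdjB (g h k : BilForm V) : BilForm V :=
  (-1 : ℝ) • (sandwichB g h k + sandwichB g k h) + (1 / 2 * g02B g h k) • g

/-- By the cyclicity of the trace, `metricVarB` and `metricVarAdjB` are adjoint pointwise. -/
lemma g02B_metricVarB {g : BilForm V} (hg : g.IsInvertible) (m h k : BilForm V) :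
    g02B g (metricVarB g m h) k = g02B g m (metricVarAdjB g h k) := by
  have e1 : g02B g (sandwichB g h m) k = g02B g m (sandwichB g k h) := by
    rw [g02B_comm, g02B_comm g m]
    simp only [g02B, sandwichB_assoc]
  have e2 : g02B g (sandwichB g m h) k = g02B g m (sandwichB g h k) := rfl
  have e3 : g02B g m g = traceB g m := by rw [g02B, sandwichB_self_right hg]
  simp only [metricVarB, metricVarAdjB, g02B_add_left, g02B_add_right, g02B_smul_left,
    g02B_smul_right, e1, e2, e3]
  ring

/-- `h g⁻¹ k` and `k g⁻¹ h` are transposes of each other. -/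
lemma sandwichB_symm {g h k : BilForm V} (hg : g.IsInvertible) (gs : ∀ u v, g u v = g v u)
    (hs : ∀ u v, h u v = h v u) (ks : ∀ u v, k u v = k v u) (u v : V) :
    sandwichB g h k u v = sandwichB g k h v u := by
  have a : h (ContinuousLinearMap.inverse g (k u)) v =
      g (ContinuousLinearMap.inverse g (h v)) (ContinuousLinearMap.inverse g (k u)) := by
    rw [self_comp_inverse hg, hs]
  have b : k (ContinuousLinearMap.inverse g (h v)) u =
      g (ContinuousLinearMap.inverse g (k u)) (ContinuousLinearMap.inverse g (h v)) := by
    rw [self_comp_inverse hg, ks]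
  simp only [sandwichB, ContinuousLinearMap.comp_apply]
  rw [a, b, gs]

lemma metricVarB_symm {g m h : BilForm V} (hg : g.IsInvertible) (gs : ∀ u v, g u v = g v u)
    (ms : ∀ u v, m u v = m v u) (hs : ∀ u v, h u v = h v u) (u v : V) :
    metricVarB g m h u v = metricVarB g m h v u := by
  simp only [metricVarB, add_apply, smul_apply]
  rw [sandwichB_symm hg gs ms hs u v, sandwichB_symm hg gs hs ms u v, hs u v,
    add_comm (sandwichB g h m v u)]

lemma metricVarAdjB_symm {g h k : BilForm V} (hg : g.IsInvertible) (gs : ∀ u v, g u v = g v u)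
    (hs : ∀ u v, h u v = h v u) (ks : ∀ u v, k u v = k v u) (u v : V) :
    metricVarAdjB g h k u v = metricVarAdjB g h k v u := by
  simp only [metricVarAdjB, add_apply, smul_apply]
  rw [sandwichB_symm hg gs hs ks u v, sandwichB_symm hg gs ks hs u v, gs u v,
    add_comm (sandwichB g k h v u)]

lemma metricVarB_pullB (T : V' ≃L[ℝ] V) {g : BilForm V} (hg : g.IsInvertible) (m h : BilForm V) :
    metricVarB (pullB (T : V' →L[ℝ] V) g) (pullB (T : V' →L[ℝ] V) m) (pullB (T : V' →L[ℝ] V) h) =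
      pullB (T : V' →L[ℝ] V) (metricVarB g m h) := by
  simp only [metricVarB, pullB_add, pullB_smul, sandwichB_pullB T hg, traceB_pullB T hg]

lemma metricVarAdjB_pullB (T : V' ≃L[ℝ] V) {g : BilForm V} (hg : g.IsInvertible)
    (h k : BilForm V) :
    metricVarAdjB (pullB (T : V' →L[ℝ] V) g) (pullB (T : V' →L[ℝ] V) h)
      (pullB (T : V' →L[ℝ] V) k) = pullB (T : V' →L[ℝ] V) (metricVarAdjB g h k) := by
  simp only [metricVarAdjB, pullB_add, pullB_smul, sandwichB_pullB T hg, g02B_pullB T hg]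

/-- Positive forms: `0 < g(u, u)` for `u ≠ 0`. -/
def PosForm (g : BilForm V) : Prop := ∀ u, u ≠ 0 → 0 < g u u

/-- A positive form is injective as a map to the dual, which has the same dimension. -/
lemma PosForm.isInvertible [FiniteDimensional ℝ V] [T2Space V] {g : BilForm V} (hg : PosForm g) :
    g.IsInvertible := by
  have inj : Function.Injective
      ((ContinuousLinearMap.coeLM ℝ).comp (g : V →ₗ[ℝ] V →L[ℝ] ℝ) : V →ₗ[ℝ] V →ₗ[ℝ] ℝ) := by
    rw [← LinearMap.ker_eq_bot, LinearMap.ker_eq_bot']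
    intro u hu
    by_contra h
    have h1 := hg u h
    have : g u u = 0 := by
      have := congrArg (fun l : V →ₗ[ℝ] ℝ => l u) hu
      simpa using this
    exact h1.ne' this
  let e1 : V ≃ₗ[ℝ] (V →ₗ[ℝ] ℝ) :=
    LinearMap.linearEquivOfInjective _ inj (Subspace.dual_finrank_eq (K := ℝ) (V := V)).symm
  let e : V ≃ₗ[ℝ] (V →L[ℝ] ℝ) := e1.trans LinearMap.toContinuousLinearMap
  have he : ∀ u, e u = g u := by intro u; ext v; rfl
  have hc : Continuous e.symm := by
    have : FiniteDimensional ℝ (V →L[ℝ] ℝ) := e.finiteDimensional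
    exact LinearMap.continuous_of_finiteDimensional (e.symm : (V →L[ℝ] ℝ) →ₗ[ℝ] V)
  refine ⟨ContinuousLinearEquiv.mk e ?_ hc, ?_⟩
  · have : (e : V → V →L[ℝ] ℝ) = g := funext he
    change Continuous (e : V → V →L[ℝ] ℝ)
    rw [this]; exact g.continuous
  · ext u v
    change e u v = g u v
    rw [he]

lemma PosForm.pullB {g : BilForm V} (hg : PosForm g) (T : V' ≃L[ℝ] V) :
    PosForm (pullB (T : V' →L[ℝ] V) g) := fun u hu => by
  simpa using hg (T u) (by simpa using hu)

end LinearAlgebra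

/-! ### Calculus of bilinear forms on Euclidean space -/

section EuclideanForms

variable {n : ℕ}

/-- Bilinear forms on the model space. -/
abbrev ModelForm (n : ℕ) : Type :=
  EuclideanSpace ℝ (Fin n) →L[ℝ] EuclideanSpace ℝ (Fin n) →L[ℝ] ℝ

/-- The trace as a continuous linear functional. -/
def traceCLM (n : ℕ) :
    (EuclideanSpace ℝ (Fin n) →L[ℝ] EuclideanSpace ℝ (Fin n)) →L[ℝ] ℝ :=
  LinearMap.toContinuousLinearMap
    ((LinearMap.trace ℝ (EuclideanSpace ℝ (Fin n))).comp (ContinuousLinearMap.coeLM ℝ))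

/-- The Gram determinant `det a(eᵢ, eⱼ)` in the standard basis. -/
def gramDet (a : ModelForm n) : ℝ :=
  Matrix.det (Matrix.of fun i j =>
    a (EuclideanSpace.single i (1 : ℝ)) (EuclideanSpace.single j (1 : ℝ)))

/-- The integrand of `∫ g⁰₂(h, k) vol(g)` in coordinates. -/
def pairingDensity (a b c : ModelForm n) : ℝ := g02B a b c * Real.sqrt (gramDet a)

section ContDiff

variable {Z : Type*} [NormedAddCommGroup Z] [NormedSpace ℝ Z] {s : Set Z}
  {a b c : Z → ModelForm n} {k : WithTop ℕ∞}

lemma contDiffOn_inverse (ha : ContDiffOn ℝ k a s) (hi : ∀ z ∈ s, (a z).IsInvertible) :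
    ContDiffOn ℝ k (fun z => ContinuousLinearMap.inverse (a z)) s := fun z hz =>
  (hi z hz).contDiffAt_map_inverse.comp_contDiffWithinAt z (ha z hz)

lemma contDiffOn_sandwichB (ha : ContDiffOn ℝ k a s) (hi : ∀ z ∈ s, (a z).IsInvertible)
    (hb : ContDiffOn ℝ k b s) (hc : ContDiffOn ℝ k c s) :
    ContDiffOn ℝ k (fun z => sandwichB (a z) (b z) (c z)) s :=
  hb.clm_comp ((contDiffOn_inverse ha hi).clm_comp hc)

lemma contDiffOn_traceB (ha : ContDiffOn ℝ k a s) (hi : ∀ z ∈ s, (a z).IsInvertible)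
    (hb : ContDiffOn ℝ k b s) : ContDiffOn ℝ k (fun z => traceB (a z) (b z)) s :=
  (traceCLM n).contDiff.comp_contDiffOn ((contDiffOn_inverse ha hi).clm_comp hb)

lemma contDiffOn_g02B (ha : ContDiffOn ℝ k a s) (hi : ∀ z ∈ s, (a z).IsInvertible)
    (hb : ContDiffOn ℝ k b s) (hc : ContDiffOn ℝ k c s) :
    ContDiffOn ℝ k (fun z => g02B (a z) (b z) (c z)) s :=
  contDiffOn_traceB ha hi (contDiffOn_sandwichB ha hi hb hc)

lemma contDiffOn_neg_add_smul {F : Type*} [NormedAddCommGroup F] [NormedSpace ℝ F]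
    {f₁ f₂ f₃ : Z → F} {t : Z → ℝ} (h₁ : ContDiffOn ℝ k f₁ s) (h₂ : ContDiffOn ℝ k f₂ s)
    (h₃ : ContDiffOn ℝ k f₃ s) (ht : ContDiffOn ℝ k t s) :
    ContDiffOn ℝ k (fun z => (-1 : ℝ) • (f₁ z + f₂ z) + (1 / 2 * t z) • f₃ z) s :=
  (contDiffOn_const.smul (h₁.add h₂)).add ((contDiffOn_const.mul ht).smul h₃)

lemma contDiffOn_metricVarB (ha : ContDiffOn ℝ k a s) (hi : ∀ z ∈ s, (a z).IsInvertible)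
    (hb : ContDiffOn ℝ k b s) (hc : ContDiffOn ℝ k c s) :
    ContDiffOn ℝ k (fun z => metricVarB (a z) (b z) (c z)) s :=
  contDiffOn_neg_add_smul (contDiffOn_sandwichB ha hi hb hc) (contDiffOn_sandwichB ha hi hc hb) hc
    (contDiffOn_traceB ha hi hb)

lemma contDiffOn_metricVarAdjB (ha : ContDiffOn ℝ k a s) (hi : ∀ z ∈ s, (a z).IsInvertible)
    (hb : ContDiffOn ℝ k b s) (hc : ContDiffOn ℝ k c s) :
    ContDiffOn ℝ k (fun z => metricVarAdjB (a z) (b z) (c z)) s :=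
  contDiffOn_neg_add_smul (contDiffOn_sandwichB ha hi hb hc) (contDiffOn_sandwichB ha hi hc hb) ha
    (contDiffOn_g02B ha hi hb hc)

end ContDiff

lemma contDiff_eval_eval {F : Type*} [NormedAddCommGroup F] [NormedSpace ℝ F] (u v : F)
    {k : WithTop ℕ∞} : ContDiff ℝ k (fun a : F →L[ℝ] F →L[ℝ] ℝ => a u v) :=
  (contDiff_id.clm_apply contDiff_const).clm_apply contDiff_const

lemma contDiff_gramDet {k : WithTop ℕ∞} : ContDiff ℝ k (gramDet (n := n)) := by
  unfold gramDet
  simp only [Matrix.det_apply, Matrix.of_apply, Units.smul_def, zsmul_eq_mul]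
  exact ContDiff.sum fun σ _ => contDiff_const.mul
    (contDiff_prod fun i _ => contDiff_eval_eval _ _)

lemma continuousOn_pairingDensity {Z : Type*} [NormedAddCommGroup Z] [NormedSpace ℝ Z] {s : Set Z}
    {a b c : Z → ModelForm n} (ha : ContinuousOn a s) (hi : ∀ z ∈ s, (a z).IsInvertible)
    (hb : ContinuousOn b s) (hc : ContinuousOn c s) :
    ContinuousOn (fun z => pairingDensity (a z) (b z) (c z)) s :=
  (contDiffOn_g02B (k := 0) (contDiffOn_zero.2 ha) hi (contDiffOn_zero.2 hb)
    (contDiffOn_zero.2 hc)).continuousOn.mul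
    (Real.continuous_sqrt.comp_continuousOn
      ((contDiff_gramDet (k := 0)).continuous.comp_continuousOn ha))

/-- `d(a⁻¹) = -a⁻¹ a' a⁻¹`. -/
lemma hasDerivAt_inverse {a : ℝ → ModelForm n} {a' : ModelForm n} {s : ℝ} (ha : HasDerivAt a a' s)
    (hi : (a s).IsInvertible) :
    HasDerivAt (fun s => ContinuousLinearMap.inverse (a s))
      (-((ContinuousLinearMap.inverse (a s)).comp
        (a'.comp (ContinuousLinearMap.inverse (a s))))) s := by
  have hS := (((hi.contDiffAt_map_inverse (n := 1)).differentiableAt (by simp)).comp s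
    ha.differentiableAt).hasDerivAt
  rw [Function.comp_def] at hS
  set S' := deriv (fun s => ContinuousLinearMap.inverse (a s)) s with hS'
  have h1 := ha.clm_comp hS
  -- `a ∘ a⁻¹ = 1` near `s`
  have hev : ∀ᶠ t in 𝓝 s, (a t).comp (ContinuousLinearMap.inverse (a t)) =
      ContinuousLinearMap.id ℝ (EuclideanSpace ℝ (Fin n) →L[ℝ] ℝ) := by
    obtain ⟨e, he⟩ := hi
    have : ∀ᶠ t in 𝓝 s, a t ∈ range ((↑) : (EuclideanSpace ℝ (Fin n) ≃L[ℝ]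
        (EuclideanSpace ℝ (Fin n) →L[ℝ] ℝ)) → ModelForm n) :=
      ha.continuousAt.eventually_mem (he ▸ e.nhds)
    filter_upwards [this] with t ht
    obtain ⟨e', he'⟩ := ht
    ext u v
    rw [ContinuousLinearMap.comp_apply, self_comp_inverse ⟨e', he'⟩]; rfl
  have h2 := (h1.congr_of_eventuallyEq (hev.mono fun t ht => ht.symm)).unique
    (hasDerivAt_const s _)
  refine hS.congr_deriv ?_
  ext1 u
  have h3 := congrArg (fun L : (EuclideanSpace ℝ (Fin n) →L[ℝ] ℝ) →L[ℝ]
    (EuclideanSpace ℝ (Fin n) →L[ℝ] ℝ) => ContinuousLinearMap.inverse (a s) (L u)) h2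
  simp only [add_apply, ContinuousLinearMap.comp_apply, map_add, inverse_comp_self hi,
    zero_apply, map_zero] at h3
  have h4 := (neg_eq_of_add_eq_zero_right h3).symm
  rw [h4]; rfl

/-- A `C¹` function along a curve has the derivative that it has along the tangent line. -/
lemma hasDerivAt_comp_of_line {F : Type*} [NormedAddCommGroup F] [NormedSpace ℝ F] {f : F → ℝ}
    {a : ℝ → F} {a' : F} {s d : ℝ} (hf : ContDiffAt ℝ 1 f (a s)) (ha : HasDerivAt a a' s)
    (hd : HasDerivAt (fun r : ℝ => f (a s + r • a')) d 0) :
    HasDerivAt (fun s => f (a s)) d s := by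
  have hf := (hf.differentiableAt one_ne_zero).hasFDerivAt
  have h1 := hf.comp_hasDerivAt s ha
  have h2 : HasDerivAt (fun r : ℝ => a s + r • a') a' 0 := by
    simpa using ((hasDerivAt_id (0 : ℝ)).smul_const a').const_add (a s)
  have h3 : HasDerivAt (fun r : ℝ => f (a s + r • a')) (fderiv ℝ f (a s) a') 0 := by
    refine HasFDerivAt.comp_hasDerivAt (0 : ℝ) ?_ h2
    simpa using hf
  exact h1.congr_deriv (h3.unique hd)

lemma apply_eq_sum (L : EuclideanSpace ℝ (Fin n) →L[ℝ] ℝ) (v : EuclideanSpace ℝ (Fin n)) :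
    L v = ∑ i, v i * L (EuclideanSpace.single i (1 : ℝ)) := by
  conv_lhs => rw [← (EuclideanSpace.basisFun (Fin n) ℝ).sum_repr v]
  simp [map_sum]

lemma trace_eq_sum (N : EuclideanSpace ℝ (Fin n) →L[ℝ] EuclideanSpace ℝ (Fin n)) :
    LinearMap.trace ℝ _ (N : EuclideanSpace ℝ (Fin n) →ₗ[ℝ] EuclideanSpace ℝ (Fin n)) =
      ∑ i, N (EuclideanSpace.single i (1 : ℝ)) i := by
  rw [LinearMap.trace_eq_matrix_trace ℝ (EuclideanSpace.basisFun (Fin n) ℝ).toBasis, Matrix.trace]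
  simp [LinearMap.toMatrix_apply]

/-- Jacobi's formula for the Gram determinant: with `N = a⁻¹ a'` the Gram matrix of `a + r a'` is
`(1 + r Nᵀ)` times that of `a`. -/
lemma hasDerivAt_gramDet {a : ℝ → ModelForm n} {a' : ModelForm n} {s : ℝ} (ha : HasDerivAt a a' s)
    (hi : (a s).IsInvertible) :
    HasDerivAt (fun s => gramDet (a s)) (traceB (a s) a' * gramDet (a s)) s := by
  refine hasDerivAt_comp_of_line contDiff_gramDet.contDiffAt ha ?_
  set N : EuclideanSpace ℝ (Fin n) →L[ℝ] EuclideanSpace ℝ (Fin n) :=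
    (ContinuousLinearMap.inverse (a s)).comp a' with hN
  let NM : Matrix (Fin n) (Fin n) ℝ :=
    Matrix.of fun j i => N (EuclideanSpace.single j (1 : ℝ)) i
  have h4 : ∀ r : ℝ, gramDet (a s + r • a') = (1 + r • NM).det * gramDet (a s) := by
    intro r
    rw [gramDet, gramDet, ← Matrix.det_mul, add_mul, one_mul, Matrix.smul_mul]
    congr 1
    ext j k
    have h0 : (a s + r • a') (EuclideanSpace.single j (1 : ℝ)) (EuclideanSpace.single k (1 : ℝ)) =
      a s (EuclideanSpace.single j (1 : ℝ)) (EuclideanSpace.single k (1 : ℝ)) +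
      r * a' (EuclideanSpace.single j (1 : ℝ)) (EuclideanSpace.single k (1 : ℝ)) := rfl
    have h5 : a' (EuclideanSpace.single j (1 : ℝ)) = a s (N (EuclideanSpace.single j (1 : ℝ))) := by
      rw [hN, ContinuousLinearMap.comp_apply, self_comp_inverse hi]
    have h6 := apply_eq_sum (((a s).flip) (EuclideanSpace.single k (1 : ℝ)))
      (N (EuclideanSpace.single j (1 : ℝ)))
    simp only [ContinuousLinearMap.flip_apply] at h6
    rw [Matrix.of_apply, h0, h5, h6, Matrix.add_apply, Matrix.smul_apply, Matrix.mul_apply]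
    rfl
  have h5 : traceB (a s) a' = NM.trace := by
    rw [traceB, trace_eq_sum]; rfl
  simp_rw [h4, h5]
  refine HasDerivAt.mul_const ?_ _
  have h8 : (fun r : ℝ => (1 + r • NM).det) = _ :=
    funext fun r => Matrix.det_one_add_smul r NM
  rw [h8]
  -- `det (1 + r N) = 1 + r Tr N + r² p(r)` with a polynomial `p`
  set p := (1 + (Polynomial.X : Polynomial ℝ) • NM.map ⇑Polynomial.C).det.divX.divX
  have h6 : HasDerivAt (fun r : ℝ => NM.trace * r) NM.trace 0 := by
    simpa using (hasDerivAt_id (0 : ℝ)).const_mul NM.trace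
  have h7 := (p.hasDerivAt 0).mul ((hasDerivAt_id (0 : ℝ)).pow 2)
  refine ((h6.const_add 1).add h7).congr_deriv ?_
  simp

lemma gramDet_ne_zero {a : ModelForm n} (hi : a.IsInvertible) : gramDet a ≠ 0 := by
  intro h
  obtain ⟨v, hv, hv0⟩ := Matrix.exists_vecMul_eq_zero_iff.2 h
  have h1 : a (WithLp.toLp 2 v) = 0 := by
    ext w
    rw [apply_eq_sum]
    refine Finset.sum_eq_zero fun k _ => ?_
    have h2 := congrFun hv0 k
    have h6 := apply_eq_sum (a.flip (EuclideanSpace.single k (1 : ℝ))) (WithLp.toLp 2 v)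
    simp only [ContinuousLinearMap.flip_apply] at h6
    simp only [Matrix.vecMul, dotProduct, Matrix.of_apply, Pi.zero_apply] at h2
    rw [h6]
    simp [h2]
  have h2 := inverse_comp_self hi (WithLp.toLp 2 v)
  rw [h1, map_zero] at h2
  exact hv ((WithLp.toLp_injective 2 (by simpa using h2.symm)))

/-- The derivative of `g⁰₂(h, k) vol(g)` along curves of forms. -/
lemma hasDerivAt_pairingDensity {a b c : ℝ → ModelForm n} {a' b' c' : ModelForm n} {s : ℝ}
    (ha : HasDerivAt a a' s) (hb : HasDerivAt b b' s) (hc : HasDerivAt c c' s)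
    (hi : (a s).IsInvertible) :
    HasDerivAt (fun s => pairingDensity (a s) (b s) (c s))
      (pairingDensity (a s) (b' + metricVarB (a s) a' (b s)) (c s) +
        pairingDensity (a s) (b s) c') s := by
  have hS := hasDerivAt_inverse ha hi
  have h1 := (traceCLM n).hasFDerivAt.comp_hasDerivAt s
    (hS.clm_comp (hb.clm_comp (hS.clm_comp hc)))
  have h2 := (hasDerivAt_gramDet ha hi).sqrt (gramDet_ne_zero hi)
  have h3 := h1.mul h2
  refine h3.congr_deriv ?_
  have e1 : g02B (a s) (b s) (c s) = traceCLM n ((ContinuousLinearMap.inverse (a s)).comp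
    ((b s).comp ((ContinuousLinearMap.inverse (a s)).comp (c s)))) := rfl
  have e2 : g02B (a s) b' (c s) = traceCLM n ((ContinuousLinearMap.inverse (a s)).comp
    (b'.comp ((ContinuousLinearMap.inverse (a s)).comp (c s)))) := rfl
  have e3 : g02B (a s) (b s) c' = traceCLM n ((ContinuousLinearMap.inverse (a s)).comp
    ((b s).comp ((ContinuousLinearMap.inverse (a s)).comp c'))) := rfl
  have e4 : g02B (a s) (sandwichB (a s) a' (b s)) (c s) =
    traceCLM n (((ContinuousLinearMap.inverse (a s)).comp
      (a'.comp (ContinuousLinearMap.inverse (a s)))).comp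
      ((b s).comp ((ContinuousLinearMap.inverse (a s)).comp (c s)))) := rfl
  have e5 : g02B (a s) (sandwichB (a s) (b s) a') (c s) =
    traceCLM n ((ContinuousLinearMap.inverse (a s)).comp ((b s).comp
      (((ContinuousLinearMap.inverse (a s)).comp
      (a'.comp (ContinuousLinearMap.inverse (a s)))).comp (c s)))) := rfl
  have e6 : traceB (a s) a' * gramDet (a s) / (2 * √(gramDet (a s))) =
      1 / 2 * traceB (a s) a' * √(gramDet (a s)) := by
    rw [mul_div_assoc, mul_comm (2 : ℝ), ← div_div, Real.div_sqrt]; ring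
  simp only [pairingDensity, metricVarB, g02B_add_left, g02B_smul_left, e1, e2, e3, e4, e5, e6,
    Function.comp_apply, map_add, ContinuousLinearMap.comp_add, ContinuousLinearMap.neg_comp,
    ContinuousLinearMap.comp_neg, map_neg]
  ring

end EuclideanForms

/-! ### Tensor fields in charts -/

section Charts

variable {n : ℕ} {M : Type*} [TopologicalSpace M] [ChartedSpace (EuclideanSpace ℝ (Fin n)) M]

variable (n M) in
/-- The chart domain, as a subset of the model space. -/
abbrev chartTarget (p : M) : Set (EuclideanSpace ℝ (Fin n)) := (extChartAt (𝓡 n) p).target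

lemma isOpen_chartTarget (p : M) : IsOpen (chartTarget n M p) := isOpen_extChartAt_target p

lemma symm_mem_source {p : M} {y : EuclideanSpace ℝ (Fin n)} (hy : y ∈ chartTarget n M p) :
    (extChartAt (𝓡 n) p).symm y ∈ (chartAt (EuclideanSpace ℝ (Fin n)) p).source := by
  have := (extChartAt (𝓡 n) p).map_target hy
  rwa [extChartAt_source] at this

lemma exists_chart_point (x : M) :
    ∃ p : M, ∃ y ∈ chartTarget n M p, (extChartAt (𝓡 n) p).symm y = x :=
  ⟨x, extChartAt (𝓡 n) x x, mem_extChartAt_target x, extChartAt_to_inv x⟩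

variable [IsManifold (𝓡 n) ∞ M]

lemma symm_mem_baseSet {p : M} {y : EuclideanSpace ℝ (Fin n)} (hy : y ∈ chartTarget n M p) :
    (extChartAt (𝓡 n) p).symm y ∈
      (trivializationAt (EuclideanSpace ℝ (Fin n)) (TangentSpace (𝓡 n)) p).baseSet := by
  rw [TangentBundle.trivializationAt_baseSet]
  exact symm_mem_source hy

/-- The coordinate frame of the chart at `p`, as a linear map from the model space. -/
def chartFrame (p : M) (y : EuclideanSpace ℝ (Fin n)) :
    EuclideanSpace ℝ (Fin n) →L[ℝ] TangentSpace (𝓡 n) ((extChartAt (𝓡 n) p).symm y) :=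
  (trivializationAt (EuclideanSpace ℝ (Fin n)) (TangentSpace (𝓡 n)) p).symmL ℝ
    ((extChartAt (𝓡 n) p).symm y)

lemma exists_chartFrame_equiv {p : M} {y : EuclideanSpace ℝ (Fin n)} (hy : y ∈ chartTarget n M p) :
    ∃ T : EuclideanSpace ℝ (Fin n) ≃L[ℝ] TangentSpace (𝓡 n) ((extChartAt (𝓡 n) p).symm y),
      (T : EuclideanSpace ℝ (Fin n) →L[ℝ] TangentSpace (𝓡 n) ((extChartAt (𝓡 n) p).symm y)) =
        chartFrame p y ∧ ∀ X, chartFrame p y (T.symm X) = X := by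
  have h : (((trivializationAt (EuclideanSpace ℝ (Fin n)) (TangentSpace (𝓡 n)) p
    ).continuousLinearEquivAt ℝ _ (symm_mem_baseSet hy)).symm : EuclideanSpace ℝ (Fin n) →L[ℝ] _) =
      chartFrame p y := Bundle.Trivialization.symm_continuousLinearEquivAt_eq' _ _
  exact ⟨((trivializationAt (EuclideanSpace ℝ (Fin n)) (TangentSpace (𝓡 n)) p
    ).continuousLinearEquivAt ℝ _ (symm_mem_baseSet hy)).symm,
    h, fun X => by rw [← h]; exact ContinuousLinearEquiv.apply_symm_apply _ X⟩

/-- `chartFrame` is defined by the trivialization of the tangent bundle, and the frame in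
`localDensity` by the derivative of the inverse of the chart: these are the same. -/
lemma chartFrame_eq_mfderiv {p : M} {y : EuclideanSpace ℝ (Fin n)} (hy : y ∈ chartTarget n M p) :
    chartFrame p y = mfderiv 𝓘(ℝ, EuclideanSpace ℝ (Fin n)) (𝓡 n) (extChartAt (𝓡 n) p).symm y := by
  have h := TangentBundle.symmL_trivializationAt (I := 𝓡 n) (𝕜 := ℝ) (symm_mem_source hy)
  rw [(extChartAt (𝓡 n) p).right_inv hy] at h
  unfold chartFrame
  rw [h]
  have : range (𝓡 n) = univ := ModelWithCorners.range_eq_univ _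
  rw [this, mfderivWithin_univ]

/-- The coordinates of a field of bilinear forms in the chart at `p`. -/
def fieldRep (p : M) (τ : ∀ x : M, TangentForm (n := n) x) (y : EuclideanSpace ℝ (Fin n)) :
    ModelForm n :=
  pullB (chartFrame p y) (τ ((extChartAt (𝓡 n) p).symm y))

/-- The fibre coordinate of the bundle of bilinear forms in its trivialization at `p` is the
pull-back along the coordinate frame. -/
lemma trivialization_eq_pullB {p : M} {y : EuclideanSpace ℝ (Fin n)} (hy : y ∈ chartTarget n M p)
    (h : TangentForm (n := n) ((extChartAt (𝓡 n) p).symm y)) :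
    (trivializationAt (EuclideanSpace ℝ (Fin n) →L[ℝ] EuclideanSpace ℝ (Fin n) →L[ℝ] ℝ)
      (fun x : M => TangentSpace (𝓡 n) x →L[ℝ] TangentSpace (𝓡 n) x →L[ℝ] ℝ) p
      (Bundle.TotalSpace.mk' _ ((extChartAt (𝓡 n) p).symm y) h)).2 = pullB (chartFrame p y) h := by
  have hb := symm_mem_baseSet hy
  ext u v
  rw [hom_trivializationAt_apply]
  refine (inCoordinates_apply_eq₂ (E₃ := Bundle.Trivial M ℝ) hb hb (by simp)).trans ?_
  rw [pullB_apply, chartFrame, Bundle.Trivialization.symmL_apply _ hb,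
    Bundle.Trivialization.symmL_apply _ hb]
  simp
  rfl

/-- The family `τ` of fields of bilinear forms is smooth on `U × M`, in terms of coordinates. -/
def SmoothFields {W : Type*} [NormedAddCommGroup W] [NormedSpace ℝ W] (U : Set W)
    (τ : W → ∀ x : M, TangentForm (n := n) x) : Prop :=
  ∀ p : M, ContDiffOn ℝ ∞ (fun q : W × EuclideanSpace ℝ (Fin n) => fieldRep p (τ q.1) q.2)
    (U ×ˢ chartTarget n M p)

section

variable {W : Type*} [NormedAddCommGroup W] [NormedSpace ℝ W] {U : Set W}

/-- Smoothness as a section of the bundle of bilinear forms is smoothness of the coordinates. -/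
lemma smoothFields_iff (hU : IsOpen U) (τ : W → ∀ x : M, TangentForm (n := n) x) :
    ContMDiffOn (𝓘(ℝ, W).prod (𝓡 n))
      ((𝓡 n).prod 𝓘(ℝ, EuclideanSpace ℝ (Fin n) →L[ℝ] EuclideanSpace ℝ (Fin n) →L[ℝ] ℝ)) ∞
      (fun p : W × M => Bundle.TotalSpace.mk'
        (EuclideanSpace ℝ (Fin n) →L[ℝ] EuclideanSpace ℝ (Fin n) →L[ℝ] ℝ)
        (E := fun x : M => TangentSpace (𝓡 n) x →L[ℝ] TangentSpace (𝓡 n) x →L[ℝ] ℝ)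
        p.2 (τ p.1 p.2)) (U ×ˢ univ) ↔ SmoothFields U τ := by
  constructor
  · intro h p
    have hψ : ContMDiffOn 𝓘(ℝ, W × EuclideanSpace ℝ (Fin n)) (𝓘(ℝ, W).prod (𝓡 n)) ∞
        (fun q : W × EuclideanSpace ℝ (Fin n) => (q.1, (extChartAt (𝓡 n) p).symm q.2))
        (U ×ˢ chartTarget n M p) :=
      contDiff_fst.contMDiff.contMDiffOn.prodMk
        ((contMDiffOn_extChartAt_symm p).comp contDiff_snd.contMDiff.contMDiffOn fun q hq => hq.2)
    have h1 := h.comp hψ fun q hq => ⟨hq.1, mem_univ _⟩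
    have h2 := ((trivializationAt (EuclideanSpace ℝ (Fin n) →L[ℝ] EuclideanSpace ℝ (Fin n) →L[ℝ] ℝ)
      (fun x : M => TangentSpace (𝓡 n) x →L[ℝ] TangentSpace (𝓡 n) x →L[ℝ] ℝ) p).contMDiffOn_iff
      (IB := 𝓡 n) (n := ∞) (fun q hq => ?_)).1 h1
    · have h3 := h2.2
      rw [contMDiffOn_iff_contDiffOn] at h3
      exact h3.congr fun q hq => (trivialization_eq_pullB hq.2 _).symm
    · rw [Bundle.Trivialization.mem_source]
      simpa using symm_mem_source hq.2
  · rintro h ⟨u, x⟩ ⟨hu, -⟩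
    have hopen : IsOpen (U ×ˢ (chartAt (EuclideanSpace ℝ (Fin n)) x).source) :=
      hU.prod (chartAt (EuclideanSpace ℝ (Fin n)) x).open_source
    have hmem : (u, x) ∈ U ×ˢ (chartAt (EuclideanSpace ℝ (Fin n)) x).source :=
      ⟨hu, mem_chart_source _ x⟩
    suffices H : ContMDiffOn (𝓘(ℝ, W).prod (𝓡 n))
      ((𝓡 n).prod 𝓘(ℝ, EuclideanSpace ℝ (Fin n) →L[ℝ] EuclideanSpace ℝ (Fin n) →L[ℝ] ℝ)) ∞
      (fun p : W × M => Bundle.TotalSpace.mk'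
        (EuclideanSpace ℝ (Fin n) →L[ℝ] EuclideanSpace ℝ (Fin n) →L[ℝ] ℝ)
        (E := fun x : M => TangentSpace (𝓡 n) x →L[ℝ] TangentSpace (𝓡 n) x →L[ℝ] ℝ)
        p.2 (τ p.1 p.2)) (U ×ˢ (chartAt (EuclideanSpace ℝ (Fin n)) x).source) from
      (H.contMDiffAt (hopen.mem_nhds hmem)).contMDiffWithinAt
    refine ((trivializationAt (EuclideanSpace ℝ (Fin n) →L[ℝ] EuclideanSpace ℝ (Fin n) →L[ℝ] ℝ)
      (fun x : M => TangentSpace (𝓡 n) x →L[ℝ] TangentSpace (𝓡 n) x →L[ℝ] ℝ) x).contMDiffOn_iff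
      (IB := 𝓡 n) (n := ∞) (fun q hq => ?_)).2 ⟨contMDiff_snd.contMDiffOn, ?_⟩
    · rw [Bundle.Trivialization.mem_source]
      simpa using hq.2
    · have h1 := h x
      rw [← contMDiffOn_iff_contDiffOn] at h1
      have hφ : ContMDiffOn (𝓘(ℝ, W).prod (𝓡 n)) 𝓘(ℝ, W × EuclideanSpace ℝ (Fin n)) ∞
          (fun q : W × M => (q.1, extChartAt (𝓡 n) x q.2))
          (U ×ˢ (chartAt (EuclideanSpace ℝ (Fin n)) x).source) :=
        contMDiff_fst.contMDiffOn.prodMk_space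
          (contMDiffOn_extChartAt.comp contMDiff_snd.contMDiffOn fun q hq => hq.2)
      have hm : ∀ x' ∈ (chartAt (EuclideanSpace ℝ (Fin n)) x).source,
          extChartAt (𝓡 n) x x' ∈ chartTarget n M x := fun x' hx' =>
        (extChartAt (𝓡 n) x).map_source (by rwa [extChartAt_source])
      refine (h1.comp hφ fun q hq => ⟨hq.1, hm _ hq.2⟩).congr ?_
      rintro ⟨u', x'⟩ ⟨-, hx'⟩
      obtain ⟨y, hy, rfl⟩ : ∃ y ∈ chartTarget n M x, (extChartAt (𝓡 n) x).symm y = x' :=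
        ⟨_, hm x' hx', (extChartAt (𝓡 n) x).left_inv (by rwa [extChartAt_source])⟩
      rw [trivialization_eq_pullB hy]
      simp only [Function.comp_apply, (extChartAt (𝓡 n) x).right_inv hy]
      rfl

lemma isSmoothFamily_iff (hU : IsOpen U) (c : W → SymTensor n M) :
    IsSmoothFamily U c ↔ SmoothFields U (fun u x => c u x) :=
  smoothFields_iff hU (fun u x => c u x)

end

@[ext] lemma SymTensor.ext {h k : SymTensor n M} (H : ∀ x, h x = k x) : h = k :=
  Subtype.ext (ContMDiffSection.ext H)

lemma SymTensor.symm (h : SymTensor n M) (x : M) (X Y : TangentSpace (𝓡 n) x) :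
    h x X Y = h x Y X := h.2 x X Y

@[simp] lemma SymTensor.add_apply (h k : SymTensor n M) (x : M) : (h + k) x = h x + k x := rfl
@[simp] lemma SymTensor.sub_apply (h k : SymTensor n M) (x : M) : (h - k) x = h x - k x := rfl
@[simp] lemma SymTensor.smul_apply (r : ℝ) (h : SymTensor n M) (x : M) : (r • h) x = r • h x := rfl
@[simp] lemma SymTensor.zero_apply (x : M) : (0 : SymTensor n M) x = 0 := rfl

/-- A constant family is smooth, since its value is a smooth section. -/
lemma isSmoothFamily_const {W : Type*} [NormedAddCommGroup W] [NormedSpace ℝ W] (U : Set W)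
    (h : SymTensor n M) : IsSmoothFamily U (fun _ => h) :=
  (h.1.contMDiff.comp contMDiff_snd).contMDiffOn

/-- A symmetric field of bilinear forms with smooth coordinates is a symmetric tensor field. -/
lemma exists_symTensor (τ : ∀ x : M, TangentForm (n := n) x)
    (hs : ∀ x (X Y : TangentSpace (𝓡 n) x), τ x X Y = τ x Y X)
    (hτ : ∀ p : M, ContDiffOn ℝ ∞ (fieldRep p τ) (chartTarget n M p)) :
    ∃ h : SymTensor n M, ∀ x, h x = τ x := by
  have h1 : SmoothFields (univ : Set ℝ) (fun _ : ℝ => τ) := fun p =>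
    (hτ p).comp contDiff_snd.contDiffOn fun q hq => hq.2
  rw [← smoothFields_iff isOpen_univ, univ_prod_univ, contMDiffOn_univ] at h1
  have h2 : ContMDiff (𝓡 n) (𝓘(ℝ, ℝ).prod (𝓡 n)) ∞ (fun x : M => ((0 : ℝ), x)) :=
    contMDiff_const.prodMk contMDiff_id
  exact ⟨⟨⟨τ, h1.comp h2⟩, hs⟩, fun x => rfl⟩

end Charts

/-! ### Integrals over compact sets that depend on a parameter -/

section ParametricIntegrals

open MeasureTheory

variable {Y H F : Type*} [TopologicalSpace Y] [NormedAddCommGroup H] [NormedAddCommGroup F]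
  {K : Set Y} {V : Set H}

/-- A function that is continuous on `V × K`, with `K` compact, is bounded on `K` uniformly for
parameters close to a given one. -/
lemma exists_bound_of_compact (hK : IsCompact K) (hV : IsOpen V) {f : H → Y → F}
    (hf : ContinuousOn (fun q : H × Y => f q.1 q.2) (V ×ˢ K)) {u : H} (hu : u ∈ V) :
    ∃ C : ℝ, ∀ᶠ v in 𝓝 u, v ∈ V ∧ ∀ y ∈ K, ‖f v y‖ ≤ C := by
  have hfu : ContinuousOn (fun y => f u y) K :=
    hf.comp (continuous_const.prodMk continuous_id).continuousOn fun y hy => ⟨hu, hy⟩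
  obtain ⟨C, hC⟩ := hK.exists_bound_of_continuousOn hfu
  refine ⟨C + 1, (hV.eventually_mem hu).and ?_⟩
  refine hK.eventually_forall_of_forall_eventually (P := fun v y => y ∈ K → ‖f v y‖ ≤ C + 1)
    (fun y hy => ?_) |>.mono fun v h y hy => h y hy hy
  have h1 := (hf (u, y) ⟨hu, hy⟩).norm.eventually_lt_const
    (show ‖f u y‖ < C + 1 by linarith [hC y hy])
  rw [eventually_nhdsWithin_iff] at h1
  have h2 : ∀ᶠ z : H × Y in 𝓝 (u, y), z.1 ∈ V :=
    continuous_fst.continuousAt.eventually (hV.mem_nhds hu)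
  filter_upwards [h1, h2] with z hz hz2 hz3
  exact (hz ⟨hz2, hz3⟩).le

lemma continuousOn_slice {f : H → Y → F}
    (hf : ContinuousOn (fun q : H × Y => f q.1 q.2) (V ×ˢ K)) {u : H} (hu : u ∈ V) :
    ContinuousOn (f u) K :=
  hf.comp (f := fun y => (u, y)) (continuous_const.prodMk continuous_id).continuousOn
    fun _ hy => ⟨hu, hy⟩

variable [T2Space Y] [MeasurableSpace Y] [BorelSpace Y] {μ : Measure Y}
  [IsFiniteMeasureOnCompacts μ]

lemma integrableOn_slice (hK : IsCompact K) {f : H → Y → F}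
    (hf : ContinuousOn (fun q : H × Y => f q.1 q.2) (V ×ˢ K)) {u : H} (hu : u ∈ V) :
    IntegrableOn (f u) K μ :=
  (continuousOn_slice hf hu).integrableOn_compact hK

variable [NormedSpace ℝ F]

lemma continuousOn_setIntegral_of_compact (hK : IsCompact K) (hV : IsOpen V) {f : H → Y → F}
    (hf : ContinuousOn (fun q : H × Y => f q.1 q.2) (V ×ˢ K)) :
    ContinuousOn (fun u => ∫ y in K, f u y ∂μ) V := by
  intro u hu
  obtain ⟨C, hC⟩ := exists_bound_of_compact hK hV hf hu
  refine (continuousAt_of_dominated (bound := fun _ => C) ?_ ?_ ?_ ?_).continuousWithinAt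
  · filter_upwards [hV.mem_nhds hu] with v hv
    exact (integrableOn_slice hK hf hv).aestronglyMeasurable
  · filter_upwards [hC] with v hv
    exact (ae_restrict_iff' hK.measurableSet).2 (.of_forall hv.2)
  · exact integrableOn_const hK.measure_lt_top.ne
  · refine (ae_restrict_iff' hK.measurableSet).2 (.of_forall fun y hy => ?_)
    have : ContinuousOn (fun v => f v y) V :=
      hf.comp (continuous_id.prodMk continuous_const).continuousOn fun v hv => ⟨hv, hy⟩
    exact this.continuousAt (hV.mem_nhds hu)

lemma hasFDerivAt_setIntegral_of_compact [NormedSpace ℝ H] (hK : IsCompact K) (hV : IsOpen V)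
    {f : H → Y → F} {f' : H → Y → H →L[ℝ] F}
    (hf : ContinuousOn (fun q : H × Y => f q.1 q.2) (V ×ˢ K))
    (hf' : ContinuousOn (fun q : H × Y => f' q.1 q.2) (V ×ˢ K))
    (hd : ∀ u ∈ V, ∀ y ∈ K, HasFDerivAt (fun v => f v y) (f' u y) u) {u : H} (hu : u ∈ V) :
    HasFDerivAt (fun v => ∫ y in K, f v y ∂μ) (∫ y in K, f' u y ∂μ) u := by
  obtain ⟨C, hC⟩ := exists_bound_of_compact hK hV hf' hu
  refine hasFDerivAt_integral_of_dominated_of_fderiv_le (bound := fun _ => C) hC ?_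
    (integrableOn_slice hK hf hu) (integrableOn_slice hK hf' hu).aestronglyMeasurable ?_ ?_ ?_
  · filter_upwards [hV.mem_nhds hu] with v hv
    exact (integrableOn_slice hK hf hv).aestronglyMeasurable
  · exact (ae_restrict_iff' hK.measurableSet).2 (.of_forall fun y hy v hv => hv.2 y hy)
  · exact integrableOn_const hK.measure_lt_top.ne
  · exact (ae_restrict_iff' hK.measurableSet).2 (.of_forall fun y hy v hv => hd v hv.1 y hy)

lemma hasDerivAt_setIntegral_of_compact (hK : IsCompact K) {V : Set ℝ} (hV : IsOpen V)
    {f f' : ℝ → Y → F}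
    (hf : ContinuousOn (fun q : ℝ × Y => f q.1 q.2) (V ×ˢ K))
    (hf' : ContinuousOn (fun q : ℝ × Y => f' q.1 q.2) (V ×ˢ K))
    (hd : ∀ u ∈ V, ∀ y ∈ K, HasDerivAt (fun v => f v y) (f' u y) u) {u : ℝ} (hu : u ∈ V) :
    HasDerivAt (fun v => ∫ y in K, f v y ∂μ) (∫ y in K, f' u y ∂μ) u := by
  obtain ⟨C, hC⟩ := exists_bound_of_compact hK hV hf' hu
  refine (hasDerivAt_integral_of_dominated_loc_of_deriv_le (bound := fun _ => C) hC ?_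
    (integrableOn_slice hK hf hu) (integrableOn_slice hK hf' hu).aestronglyMeasurable ?_ ?_ ?_).2
  · filter_upwards [hV.mem_nhds hu] with v hv
    exact (integrableOn_slice hK hf hv).aestronglyMeasurable
  · exact (ae_restrict_iff' hK.measurableSet).2 (.of_forall fun y hy v hv => hv.2 y hy)
  · exact integrableOn_const hK.measure_lt_top.ne
  · exact (ae_restrict_iff' hK.measurableSet).2 (.of_forall fun y hy v hv => hd v hv.1 y hy)

end ParametricIntegrals

section SmoothParametricIntegrals

open MeasureTheory

universe u

variable {H : Type u} [NormedAddCommGroup H] [NormedSpace ℝ H]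

/-- By induction on `k`: the derivative of the integral is the integral of the derivative.  The
induction replaces `F` by `H →L[ℝ] F`, so that `F` and `H` have to be in the same universe. -/
lemma contDiffOn_nat_setIntegral (k : ℕ) {V : Set H} (hV : IsOpen V) {O : Set (ℝ × H)}
    (hO : IsOpen O) (hVO : ∀ θ ∈ Icc (0 : ℝ) 1, ∀ z ∈ V, (θ, z) ∈ O) :
    ∀ {F : Type u} [NormedAddCommGroup F] [NormedSpace ℝ F] {f : ℝ × H → F},
      ContDiffOn ℝ k f O → ContDiffOn ℝ k (fun z => ∫ θ in Icc (0 : ℝ) 1, f (θ, z)) V := by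
  have hsub : ∀ {F : Type u} [NormedAddCommGroup F] [NormedSpace ℝ F] {f : ℝ × H → F},
      ContinuousOn f O →
        ContinuousOn (fun q : H × ℝ => (fun z θ => f (θ, z)) q.1 q.2) (V ×ˢ Icc (0 : ℝ) 1) :=
    fun hf => hf.comp continuous_swap.continuousOn fun q hq => hVO _ hq.2 _ hq.1
  induction k with
  | zero =>
    intro F _ _ f hf
    exact contDiffOn_zero.2
      (continuousOn_setIntegral_of_compact isCompact_Icc hV (hsub hf.continuousOn))
  | succ k ih =>
    intro F _ _ f hf
    have hd : ∀ q ∈ O, DifferentiableAt ℝ f q := fun q hq =>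
      (hf.contDiffAt (hO.mem_nhds hq)).differentiableAt (by simp)
    have hf' : ContDiffOn ℝ k (fun q => (fderiv ℝ f q).comp (ContinuousLinearMap.inr ℝ ℝ H)) O :=
      (hf.fderiv_of_isOpen hO (by simp)).clm_comp contDiffOn_const
    have hder : ∀ z ∈ V, HasFDerivAt (fun z => ∫ θ in Icc (0 : ℝ) 1, f (θ, z))
        (∫ θ in Icc (0 : ℝ) 1, (fderiv ℝ f (θ, z)).comp (ContinuousLinearMap.inr ℝ ℝ H)) z := by
      intro z hz
      refine hasFDerivAt_setIntegral_of_compact isCompact_Icc hV (f := fun z θ => f (θ, z))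
        (f' := fun z θ => (fderiv ℝ f (θ, z)).comp (ContinuousLinearMap.inr ℝ ℝ H))
        (hsub hf.continuousOn) (hsub hf'.continuousOn) (fun z hz θ hθ => ?_) hz
      exact (hd _ (hVO θ hθ z hz)).hasFDerivAt.comp z (hasFDerivAt_prodMk_right θ z)
    push_cast
    refine (contDiffOn_succ_iff_fderiv_of_isOpen hV).2 ⟨fun z hz =>
      (hder z hz).differentiableAt.differentiableWithinAt, fun h => ?_, ?_⟩
    · exact absurd h (WithTop.natCast_ne_top k)
    exact (ih hf').congr fun z hz => (hder z hz).fderiv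

/-- Integration over `[0, 1]` preserves smoothness in the parameter. -/
lemma contDiffOn_setIntegral {V : Set H} (hV : IsOpen V) {O : Set (ℝ × H)}
    (hO : IsOpen O) (hVO : ∀ θ ∈ Icc (0 : ℝ) 1, ∀ z ∈ V, (θ, z) ∈ O)
    {F : Type u} [NormedAddCommGroup F] [NormedSpace ℝ F] {f : ℝ × H → F}
    (hf : ContDiffOn ℝ ∞ f O) : ContDiffOn ℝ ∞ (fun z => ∫ θ in Icc (0 : ℝ) 1, f (θ, z)) V :=
  contDiffOn_infty.2 fun k => contDiffOn_nat_setIntegral k hV hO hVO (contDiffOn_infty.1 hf k)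

end SmoothParametricIntegrals

/-! ### Smooth families of tensor fields -/

section DerivativesOfForms

variable {F W Z : Type*} [NormedAddCommGroup F] [NormedSpace ℝ F] [NormedAddCommGroup W]
  [NormedSpace ℝ W] [NormedAddCommGroup Z] [NormedSpace ℝ Z]

lemma hasFDerivAt_eval_eval_fst {f : W × Z → F →L[ℝ] F →L[ℝ] ℝ} {u : W} {y : Z}
    (hf : ContDiffAt ℝ 1 f (u, y)) (a b : F) :
    ∃ L : W →L[ℝ] ℝ, HasFDerivAt (fun u => f (u, y) a b) L u ∧
      ∀ e, L e = fderiv ℝ f (u, y) (e, 0) a b := by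
  have h1 := (hf.differentiableAt one_ne_zero).hasFDerivAt
  have h2 : HasFDerivAt (fun u : W => (u, y)) (ContinuousLinearMap.inl ℝ W Z) u :=
    hasFDerivAt_prodMk_left u y
  have h3 := h1.comp u h2
  have h4 := (h3.clm_apply (hasFDerivAt_const a u)).clm_apply (hasFDerivAt_const b u)
  exact ⟨_, h4, fun e => by simp⟩

lemma hasDerivAt_of_eval_eval {f : ℝ → F →L[ℝ] F →L[ℝ] ℝ} {t : ℝ} (hf : ContDiffAt ℝ 1 f t)
    {v : F →L[ℝ] F →L[ℝ] ℝ} (hv : ∀ a b, HasDerivAt (fun s => f s a b) (v a b) t) :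
    HasDerivAt f v t := by
  have h1 := (hf.differentiableAt one_ne_zero).hasDerivAt
  refine h1.congr_deriv ?_
  ext a b
  have h4 := (h1.clm_apply (hasDerivAt_const t a)).clm_apply (hasDerivAt_const t b)
  simpa using h4.unique (hv a b)

end DerivativesOfForms

section Families

variable {n : ℕ} {M : Type*} [TopologicalSpace M] [ChartedSpace (EuclideanSpace ℝ (Fin n)) M]
  [IsManifold (𝓡 n) ∞ M]

/-- The coordinates of a symmetric tensor field in the chart at `p`. -/
def SymTensor.rep (h : SymTensor n M) (p : M) (y : EuclideanSpace ℝ (Fin n)) : ModelForm n :=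
  fieldRep p h.eval y

lemma SymTensor.rep_apply (h : SymTensor n M) (p : M) (y a b : EuclideanSpace ℝ (Fin n)) :
    h.rep p y a b = h ((extChartAt (𝓡 n) p).symm y) (chartFrame p y a) (chartFrame p y b) := rfl

@[simp] lemma SymTensor.rep_add (h k : SymTensor n M) (p : M) (y : EuclideanSpace ℝ (Fin n)) :
    (h + k).rep p y = h.rep p y + k.rep p y := pullB_add _ _ _

@[simp] lemma SymTensor.rep_smul (r : ℝ) (h : SymTensor n M) (p : M)
    (y : EuclideanSpace ℝ (Fin n)) : (r • h).rep p y = r • h.rep p y := pullB_smul _ _ _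

lemma IsMetric.posForm {g : SymTensor n M} (hg : IsMetric g) (x : M) : PosForm (g x) := hg x

lemma IsMetric.isInvertible {g : SymTensor n M} (hg : IsMetric g) (x : M) :
    (g x).IsInvertible := (hg.posForm x).isInvertible

lemma IsMetric.rep_posForm {g : SymTensor n M} (hg : IsMetric g) {p : M}
    {y : EuclideanSpace ℝ (Fin n)} (hy : y ∈ chartTarget n M p) : PosForm (g.rep p y) := by
  obtain ⟨T, hT, hT'⟩ := exists_chartFrame_equiv hy
  rw [SymTensor.rep, fieldRep, ← hT]
  exact (hg.posForm _).pullB T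

lemma IsMetric.rep_isInvertible {g : SymTensor n M} (hg : IsMetric g) {p : M}
    {y : EuclideanSpace ℝ (Fin n)} (hy : y ∈ chartTarget n M p) :
    (g.rep p y).IsInvertible := (hg.rep_posForm hy).isInvertible

section Calculus

variable {W : Type*} [NormedAddCommGroup W] [NormedSpace ℝ W] {U : Set W}

lemma isSmoothFamily_iff_rep (hU : IsOpen U) {c : W → SymTensor n M} :
    IsSmoothFamily U c ↔ ∀ p : M, ContDiffOn ℝ ∞
      (fun q : W × EuclideanSpace ℝ (Fin n) => (c q.1).rep p q.2) (U ×ˢ chartTarget n M p) :=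
  isSmoothFamily_iff hU c

lemma IsSmoothFamily.mono {c : W → SymTensor n M} {U' : Set W} (hc : IsSmoothFamily U c)
    (h : U' ⊆ U) : IsSmoothFamily U' c :=
  ContMDiffOn.mono hc (prod_mono h le_rfl)

lemma IsSmoothFamily.comp {W' : Type*} [NormedAddCommGroup W'] [NormedSpace ℝ W'] {U' : Set W'}
    {c : W → SymTensor n M} (hc : IsSmoothFamily U c) {f : W' → W} (hf : ContDiffOn ℝ ∞ f U')
    (h : MapsTo f U' U) : IsSmoothFamily U' (fun u => c (f u)) := by
  have h1 : ContMDiffOn (𝓘(ℝ, W').prod (𝓡 n)) (𝓘(ℝ, W).prod (𝓡 n)) ∞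
      (fun q : W' × M => (f q.1, q.2)) (U' ×ˢ univ) :=
    (hf.contMDiffOn.comp contMDiff_fst.contMDiffOn fun q hq => hq.1).prodMk
      contMDiff_snd.contMDiffOn
  exact ContMDiffOn.comp hc h1 fun q hq => ⟨h hq.1, mem_univ _⟩

lemma IsSmoothFamily.congr {c d : W → SymTensor n M} (hc : IsSmoothFamily U c)
    (h : ∀ u ∈ U, d u = c u) : IsSmoothFamily U d :=
  ContMDiffOn.congr hc fun q hq => by rw [h q.1 hq.1]

lemma IsSmoothFamily.add (hU : IsOpen U) {c d : W → SymTensor n M} (hc : IsSmoothFamily U c)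
    (hd : IsSmoothFamily U d) : IsSmoothFamily U (fun u => c u + d u) := by
  rw [isSmoothFamily_iff_rep hU] at *
  intro p
  simp only [SymTensor.rep_add]
  exact (hc p).add (hd p)

lemma IsSmoothFamily.smul (hU : IsOpen U) {r : W → ℝ} {c : W → SymTensor n M}
    (hr : ContDiffOn ℝ ∞ r U) (hc : IsSmoothFamily U c) :
    IsSmoothFamily U (fun u => r u • c u) := by
  rw [isSmoothFamily_iff_rep hU] at *
  intro p
  simp only [SymTensor.rep_smul]
  exact (hr.comp contDiff_fst.contDiffOn fun q hq => hq.1).smul (hc p)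

lemma IsSmoothFamily.contDiffOn_eval (hU : IsOpen U) {c : W → SymTensor n M}
    (hc : IsSmoothFamily U c) (x : M) (X Y : TangentSpace (𝓡 n) x) :
    ContDiffOn ℝ ∞ (fun u => c u x X Y) U := by
  obtain ⟨p, y, hy, rfl⟩ := exists_chart_point (n := n) x
  obtain ⟨T, hT, hT'⟩ := exists_chartFrame_equiv hy
  have h1 := ((isSmoothFamily_iff_rep hU).1 hc p).comp
    (f := fun u : W => (u, y)) (contDiff_id.prodMk contDiff_const).contDiffOn
    (s := U) fun u hu => ⟨hu, hy⟩
  refine ((contDiff_eval_eval (T.symm X) (T.symm Y)).comp_contDiffOn h1).congr fun u _ => ?_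
  rw [Function.comp_apply, Function.comp_apply, SymTensor.rep_apply, hT', hT']

/-- A family of fields of bilinear forms that is given by its values on vectors and has smooth
coordinates is a smooth family of tensor fields. -/
lemma exists_family_of_eval (hU : IsOpen U)
    (φ : W → ∀ x : M, TangentSpace (𝓡 n) x → TangentSpace (𝓡 n) x → ℝ)
    (R : M → W × EuclideanSpace ℝ (Fin n) → ModelForm n)
    (hR : ∀ p, ContDiffOn ℝ ∞ (R p) (U ×ˢ chartTarget n M p))
    (hφ : ∀ u ∈ U, ∀ p : M, ∀ y ∈ chartTarget n M p, ∀ a b,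
      R p (u, y) a b =
        φ u ((extChartAt (𝓡 n) p).symm y) (chartFrame p y a) (chartFrame p y b))
    (hs : ∀ u ∈ U, ∀ x X Y, φ u x X Y = φ u x Y X) :
    ∃ d : W → SymTensor n M, IsSmoothFamily U d ∧ ∀ u ∈ U, ∀ x X Y, d u x X Y = φ u x X Y := by
  have h1 : ∀ u x, ∃ τ : TangentForm (n := n) x, u ∈ U → ∀ X Y, τ X Y = φ u x X Y := by
    intro u x
    by_cases hu : u ∈ U
    · obtain ⟨p, y, hy, rfl⟩ := exists_chart_point (n := n) x
      obtain ⟨T, hT, hT'⟩ := exists_chartFrame_equiv hy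
      refine ⟨pullB (T.symm : TangentSpace (𝓡 n) _ →L[ℝ] EuclideanSpace ℝ (Fin n)) (R p (u, y)),
        fun _ X Y => ?_⟩
      rw [pullB_apply]
      exact (hφ u hu p y hy _ _).trans (by
        rw [ContinuousLinearEquiv.coe_coe, hT', hT'])
    · exact ⟨0, fun h => absurd h hu⟩
  choose τ hτ using h1
  have h2 : ∀ u ∈ U, ∀ p : M, ∀ y ∈ chartTarget n M p, fieldRep p (τ u) y = R p (u, y) := by
    intro u hu p y hy
    ext a b
    rw [hφ u hu p y hy, ← hτ u _ hu]
    rfl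
  have h3 : ∀ u, ∃ d : SymTensor n M, u ∈ U → ∀ x, d x = τ u x := by
    intro u
    by_cases hu : u ∈ U
    · obtain ⟨d, hd⟩ := exists_symTensor (τ u)
        (fun x X Y => by rw [hτ u x hu, hτ u x hu, hs u hu]) (fun p =>
          ((hR p).comp (f := fun y => (u, y)) (s := chartTarget n M p)
            (contDiff_const.prodMk contDiff_id).contDiffOn
            fun y hy => ⟨hu, hy⟩).congr fun y hy => h2 u hu p y hy)
      exact ⟨d, fun _ => hd⟩
    · exact ⟨0, fun h => absurd h hu⟩
  choose d hd using h3
  refine ⟨d, (isSmoothFamily_iff_rep hU).2 fun p => (hR p).congr fun q hq => ?_,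
    fun u hu x X Y => by rw [hd u hu, hτ u x hu]⟩
  rw [← h2 q.1 hq.1 p q.2 hq.2, SymTensor.rep]
  congr 1
  funext x
  exact hd q.1 hq.1 x

lemma HasTensorDerivAt.unique {c : ℝ → SymTensor n M} {v w : SymTensor n M} {t : ℝ}
    (hv : HasTensorDerivAt c v t) (hw : HasTensorDerivAt c w t) : v = w := by
  ext x X Y
  exact (hv x X Y).unique (hw x X Y)

lemma HasTensorDerivAt.tensorDeriv_eq {c : ℝ → SymTensor n M} {v : SymTensor n M} {t : ℝ}
    (hv : HasTensorDerivAt c v t) : tensorDeriv c t = v := by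
  have h : ∃ v, HasTensorDerivAt c v t := ⟨v, hv⟩
  rw [tensorDeriv, dif_pos h]
  exact h.choose_spec.unique hv

/-- The derivative of a family of tensor fields at the parameter `u` in the direction `e`. -/
def dirDeriv (c : W → SymTensor n M) (u e : W) : SymTensor n M :=
  tensorDeriv (fun s : ℝ => c (u + s • e)) 0

lemma exists_family_fderiv (hU : IsOpen U) {c : W → SymTensor n M} (hc : IsSmoothFamily U c)
    (e : W) : ∃ d : W → SymTensor n M, IsSmoothFamily U d ∧
      ∀ u ∈ U, ∀ x X Y, d u x X Y = fderiv ℝ (fun u => c u x X Y) u e := by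
  have hc' := (isSmoothFamily_iff_rep hU).1 hc
  have ho : ∀ p : M, IsOpen (U ×ˢ chartTarget n M p) := fun p => hU.prod (isOpen_chartTarget p)
  refine exists_family_of_eval hU (fun u x X Y => fderiv ℝ (fun u => c u x X Y) u e)
    (fun p q => fderiv ℝ (fun q : W × EuclideanSpace ℝ (Fin n) => (c q.1).rep p q.2) q (e, 0))
    (fun p => ((hc' p).fderiv_of_isOpen (ho p) (by simp)).clm_apply contDiffOn_const)
    (fun u hu p y hy a b => ?_) (fun u hu x X Y => ?_)
  · obtain ⟨L, hL, hLe⟩ := hasFDerivAt_eval_eval_fst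
      (((hc' p).contDiffAt ((ho p).mem_nhds (show (u, y) ∈ _ from ⟨hu, hy⟩))).of_le (by simp)) a b
    rw [← hLe e, ← hL.fderiv]
    rfl
  · simp only [(c _).symm x X Y]

lemma IsSmoothFamily.hasFDerivAt_eval (hU : IsOpen U) {c : W → SymTensor n M}
    (hc : IsSmoothFamily U c) {u : W} (hu : u ∈ U) (x : M) (X Y : TangentSpace (𝓡 n) x) :
    HasFDerivAt (fun u => c u x X Y) (fderiv ℝ (fun u => c u x X Y) u) u :=
  (((hc.contDiffOn_eval hU x X Y).contDiffAt (hU.mem_nhds hu)).differentiableAt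
    (by simp)).hasFDerivAt

/-- A smooth family has directional derivatives, and they can be computed on pairs of vectors. -/
lemma dirDeriv_apply (hU : IsOpen U) {c : W → SymTensor n M} (hc : IsSmoothFamily U c) {u : W}
    (hu : u ∈ U) (e : W) (x : M) (X Y : TangentSpace (𝓡 n) x) :
    dirDeriv c u e x X Y = fderiv ℝ (fun u => c u x X Y) u e := by
  obtain ⟨d, -, hd⟩ := exists_family_fderiv hU hc e
  rw [← hd u hu]
  have h1 : HasTensorDerivAt (fun s : ℝ => c (u + s • e)) (d u) 0 := by
    intro x X Y
    rw [hd u hu]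
    have h2 : HasDerivAt (fun s : ℝ => u + s • e) e 0 := by
      simpa using ((hasDerivAt_id (0 : ℝ)).smul_const e).const_add u
    refine HasFDerivAt.comp_hasDerivAt (0 : ℝ) (f := fun s : ℝ => u + s • e)
      (l := fun u => c u x X Y) ?_ h2
    simpa using hc.hasFDerivAt_eval hU hu x X Y
  rw [dirDeriv, h1.tensorDeriv_eq]

lemma IsSmoothFamily.dirDeriv (hU : IsOpen U) {c : W → SymTensor n M} (hc : IsSmoothFamily U c)
    (e : W) : IsSmoothFamily U (fun u => dirDeriv c u e) := by
  obtain ⟨d, hd, hd'⟩ := exists_family_fderiv hU hc e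
  refine hd.congr fun u hu => ?_
  ext x X Y
  rw [hd' u hu, dirDeriv_apply hU hc hu]

/-- The chain rule for a smooth family along a curve of parameters. -/
lemma IsSmoothFamily.hasTensorDerivAt_comp (hU : IsOpen U) {c : W → SymTensor n M}
    (hc : IsSmoothFamily U c) {γ : ℝ → W} {γ' : W} {t : ℝ} (hγ : HasDerivAt γ γ' t)
    (ht : γ t ∈ U) :
    HasTensorDerivAt (fun s => c (γ s)) (MetricSpaceOfMetrics.dirDeriv c (γ t) γ') t := by
  intro x X Y
  rw [dirDeriv_apply hU hc ht]
  exact HasFDerivAt.comp_hasDerivAt t (l := fun u => c u x X Y)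
    (hc.hasFDerivAt_eval hU ht x X Y) hγ

lemma dirDeriv_add (hU : IsOpen U) {c : W → SymTensor n M} (hc : IsSmoothFamily U c) {u : W}
    (hu : u ∈ U) (e e' : W) : dirDeriv c u (e + e') = dirDeriv c u e + dirDeriv c u e' := by
  ext x X Y
  simp only [SymTensor.add_apply, add_apply]
  rw [dirDeriv_apply hU hc hu, dirDeriv_apply hU hc hu, dirDeriv_apply hU hc hu, map_add]

lemma dirDeriv_smul (hU : IsOpen U) {c : W → SymTensor n M} (hc : IsSmoothFamily U c) {u : W}
    (hu : u ∈ U) (r : ℝ) (e : W) : dirDeriv c u (r • e) = r • dirDeriv c u e := by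
  ext x X Y
  simp only [SymTensor.smul_apply, smul_apply]
  rw [dirDeriv_apply hU hc hu, dirDeriv_apply hU hc hu, map_smul]

end Calculus

/-! ### Curves of tensor fields -/

lemma IsSmoothFamily.hasTensorDerivAt {U : Set ℝ} (hU : IsOpen U) {c : ℝ → SymTensor n M}
    (hc : IsSmoothFamily U c) {t : ℝ} (ht : t ∈ U) : HasTensorDerivAt c (tensorDeriv c t) t := by
  have h := hc.hasTensorDerivAt_comp hU (hasDerivAt_id t) ht
  rwa [← h.tensorDeriv_eq] at h

lemma IsSmoothFamily.tensorDeriv {U : Set ℝ} (hU : IsOpen U) {c : ℝ → SymTensor n M}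
    (hc : IsSmoothFamily U c) : IsSmoothFamily U (tensorDeriv c) :=
  (hc.dirDeriv hU 1).congr fun _ hu =>
    (hc.hasTensorDerivAt_comp hU (hasDerivAt_id _) hu).tensorDeriv_eq

lemma IsSmoothFamily.hasDerivAt_rep {U : Set ℝ} (hU : IsOpen U) {c : ℝ → SymTensor n M}
    (hc : IsSmoothFamily U c) {t : ℝ} (ht : t ∈ U) {v : SymTensor n M}
    (hv : HasTensorDerivAt c v t) {p : M} {y : EuclideanSpace ℝ (Fin n)}
    (hy : y ∈ chartTarget n M p) :
    HasDerivAt (fun s => (c s).rep p y) (v.rep p y) t := by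
  have h1 := ((isSmoothFamily_iff_rep hU).1 hc p).comp
    (f := fun u : ℝ => (u, y)) (contDiff_id.prodMk contDiff_const).contDiffOn
    (s := U) fun u hu => ⟨hu, hy⟩
  have h2 : ContDiffAt ℝ 1 (fun s => (c s).rep p y) t :=
    (h1.contDiffAt (hU.mem_nhds ht)).of_le (by simp)
  refine hasDerivAt_of_eval_eval h2 fun a b => ?_
  exact hv ((extChartAt (𝓡 n) p).symm y) (chartFrame p y a) (chartFrame p y b)

lemma hasTensorDerivAt_congr {c d : ℝ → SymTensor n M} {v : SymTensor n M} {t : ℝ}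
    (hv : HasTensorDerivAt c v t) (h : ∀ᶠ s in 𝓝 t, d s = c s) : HasTensorDerivAt d v t :=
  fun x X Y => (hv x X Y).congr_of_eventuallyEq (h.mono fun s hs => by simp only [hs])

end Families

section MetricVariation

variable {n : ℕ} {M : Type*} [TopologicalSpace M] [ChartedSpace (EuclideanSpace ℝ (Fin n)) M]
  [IsManifold (𝓡 n) ∞ M]

/-! ### The variation of the `L²` product with the metric, and its adjoint -/

lemma exists_metricVar {g : SymTensor n M} (hg : IsMetric g) (m h : SymTensor n M) :
    ∃ X : SymTensor n M, ∀ x, X x = metricVarB (g x) (m x) (h x) := by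
  refine exists_symTensor _ (fun x => metricVarB_symm (hg.isInvertible x) (g.symm x) (m.symm x)
    (h.symm x)) fun p => ?_
  have hr : ∀ k : SymTensor n M, ContDiffOn ℝ ∞ (k.rep p) (chartTarget n M p) := fun k =>
    ((isSmoothFamily_iff_rep isOpen_univ).1 (isSmoothFamily_const (univ : Set ℝ) k) p).comp
      (f := fun y => ((0 : ℝ), y)) (contDiff_const.prodMk contDiff_id).contDiffOn
      fun y hy => ⟨mem_univ _, hy⟩
  refine (contDiffOn_metricVarB (hr g) (fun y hy => hg.rep_isInvertible hy) (hr m) (hr h)).congr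
    fun y hy => ?_
  obtain ⟨T, hT, -⟩ := exists_chartFrame_equiv hy
  simp only [SymTensor.rep, fieldRep, ← hT]
  exact (metricVarB_pullB T (hg.isInvertible _) _ _).symm

lemma exists_metricVarAdj {g : SymTensor n M} (hg : IsMetric g) (h k : SymTensor n M) :
    ∃ X : SymTensor n M, ∀ x, X x = metricVarAdjB (g x) (h x) (k x) := by
  refine exists_symTensor _ (fun x => metricVarAdjB_symm (hg.isInvertible x) (g.symm x) (h.symm x)
    (k.symm x)) fun p => ?_
  have hr : ∀ k : SymTensor n M, ContDiffOn ℝ ∞ (k.rep p) (chartTarget n M p) := fun k =>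
    ((isSmoothFamily_iff_rep isOpen_univ).1 (isSmoothFamily_const (univ : Set ℝ) k) p).comp
      (f := fun y => ((0 : ℝ), y)) (contDiff_const.prodMk contDiff_id).contDiffOn
      fun y hy => ⟨mem_univ _, hy⟩
  refine (contDiffOn_metricVarAdjB (hr g) (fun y hy => hg.rep_isInvertible hy) (hr h)
    (hr k)).congr fun y hy => ?_
  obtain ⟨T, hT, -⟩ := exists_chartFrame_equiv hy
  simp only [SymTensor.rep, fieldRep, ← hT]
  exact (metricVarAdjB_pullB T (hg.isInvertible _) _ _).symm

open Classical in
/-- The tensor field `-m g⁻¹ h - h g⁻¹ m + ½ Tr(g⁻¹ m) h` of a metric `g` (and `0` if `g` is not a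
metric). -/
def metricVar (g m h : SymTensor n M) : SymTensor n M :=
  if hg : IsMetric g then (exists_metricVar hg m h).choose else 0

open Classical in
/-- The tensor field `-h g⁻¹ k - k g⁻¹ h + ½ g⁰₂(h, k) g` of a metric `g` (and `0` if `g` is not a
metric). -/
def metricVarAdj (g h k : SymTensor n M) : SymTensor n M :=
  if hg : IsMetric g then (exists_metricVarAdj hg h k).choose else 0

lemma metricVar_apply {g : SymTensor n M} (hg : IsMetric g) (m h : SymTensor n M) (x : M) :
    metricVar g m h x = metricVarB (g x) (m x) (h x) := by
  rw [metricVar, dif_pos hg]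
  exact (exists_metricVar hg m h).choose_spec x

lemma metricVarAdj_apply {g : SymTensor n M} (hg : IsMetric g) (h k : SymTensor n M) (x : M) :
    metricVarAdj g h k x = metricVarAdjB (g x) (h x) (k x) := by
  rw [metricVarAdj, dif_pos hg]
  exact (exists_metricVarAdj hg h k).choose_spec x

lemma metricVar_rep {g : SymTensor n M} (hg : IsMetric g) (m h : SymTensor n M) {p : M}
    {y : EuclideanSpace ℝ (Fin n)} (hy : y ∈ chartTarget n M p) :
    (metricVar g m h).rep p y = metricVarB (g.rep p y) (m.rep p y) (h.rep p y) := by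
  obtain ⟨T, hT, -⟩ := exists_chartFrame_equiv hy
  simp only [SymTensor.rep, fieldRep, ← hT, metricVar_apply hg]
  exact (metricVarB_pullB T (hg.isInvertible _) _ _).symm

lemma metricVarAdj_rep {g : SymTensor n M} (hg : IsMetric g) (h k : SymTensor n M) {p : M}
    {y : EuclideanSpace ℝ (Fin n)} (hy : y ∈ chartTarget n M p) :
    (metricVarAdj g h k).rep p y = metricVarAdjB (g.rep p y) (h.rep p y) (k.rep p y) := by
  obtain ⟨T, hT, -⟩ := exists_chartFrame_equiv hy
  simp only [SymTensor.rep, fieldRep, ← hT, metricVarAdj_apply hg]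
  exact (metricVarAdjB_pullB T (hg.isInvertible _) _ _).symm

variable {W : Type*} [NormedAddCommGroup W] [NormedSpace ℝ W] {U : Set W}

lemma IsSmoothFamily.metricVar (hU : IsOpen U) {g m h : W → SymTensor n M}
    (hgm : ∀ u ∈ U, IsMetric (g u)) (hg : IsSmoothFamily U g) (hm : IsSmoothFamily U m)
    (hh : IsSmoothFamily U h) :
    IsSmoothFamily U (fun u => metricVar (g u) (m u) (h u)) := by
  rw [isSmoothFamily_iff_rep hU] at *
  intro p
  exact (contDiffOn_metricVarB (hg p) (fun q hq => (hgm q.1 hq.1).rep_isInvertible hq.2) (hm p)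
    (hh p)).congr fun q hq => metricVar_rep (hgm q.1 hq.1) _ _ hq.2

lemma IsSmoothFamily.metricVarAdj (hU : IsOpen U) {g h k : W → SymTensor n M}
    (hgm : ∀ u ∈ U, IsMetric (g u)) (hg : IsSmoothFamily U g) (hh : IsSmoothFamily U h)
    (hk : IsSmoothFamily U k) :
    IsSmoothFamily U (fun u => metricVarAdj (g u) (h u) (k u)) := by
  rw [isSmoothFamily_iff_rep hU] at *
  intro p
  exact (contDiffOn_metricVarAdjB (hg p) (fun q hq => (hgm q.1 hq.1).rep_isInvertible hq.2) (hh p)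
    (hk p)).congr fun q hq => metricVarAdj_rep (hgm q.1 hq.1) _ _ hq.2

lemma metricVarB_add_smul {V : Type*} [AddCommGroup V] [Module ℝ V] [TopologicalSpace V]
    [IsTopologicalAddGroup V] [ContinuousSMul ℝ V] (g m h k : BilForm V) (r : ℝ) :
    metricVarB g m (h + r • k) = metricVarB g m h + r • metricVarB g m k ∧
    metricVarB g (h + r • k) m = metricVarB g h m + r • metricVarB g k m ∧
    metricVarAdjB g m (h + r • k) = metricVarAdjB g m h + r • metricVarAdjB g m k ∧
    metricVarAdjB g (h + r • k) m = metricVarAdjB g h m + r • metricVarAdjB g k m := by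
  refine ⟨?_, ?_, ?_, ?_⟩ <;>
  · simp only [metricVarB, metricVarAdjB, sandwichB_add_left, sandwichB_add_right,
      sandwichB_smul_left, sandwichB_smul_right, traceB_add, traceB_smul, g02B_add_left,
      g02B_add_right, g02B_smul_left, g02B_smul_right]
    module

/-! ### Positivity is an open condition -/

lemma isOpen_posForm : IsOpen {a : ModelForm n | PosForm a} := by
  have h : {a : ModelForm n | PosForm a} =
      {a | ∀ v ∈ Metric.sphere (0 : EuclideanSpace ℝ (Fin n)) 1, 0 < a v v} := by
    ext a
    refine ⟨fun ha v hv => ha v fun h0 => ?_, fun ha v hv => ?_⟩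
    · rw [h0] at hv; simp at hv
    · have hn : 0 < ‖v‖ := norm_pos_iff.2 hv
      have h1 := ha (‖v‖⁻¹ • v) (by simp [norm_smul, hn.ne'])
      have h2 : ∀ (r : ℝ) (w : EuclideanSpace ℝ (Fin n)), a (r • w) (r • w) = r * (r * a w w) := by
        intro r w; simp
      rw [← smul_inv_smul₀ hn.ne' v, h2]
      positivity
  rw [h, isOpen_iff_mem_nhds]
  intro a ha
  refine (isCompact_sphere (0 : EuclideanSpace ℝ (Fin n)) 1).eventually_forall_of_forall_eventually
    (P := fun (b : ModelForm n) v => 0 < b v v) fun v hv => ?_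
  have hc : ContDiff ℝ 0 (fun z : ModelForm n × EuclideanSpace ℝ (Fin n) => z.1 z.2 z.2) :=
    (contDiff_fst.clm_apply contDiff_snd).clm_apply contDiff_snd
  exact hc.continuous.continuousAt.eventually (lt_mem_nhds (ha v hv))

/-- On a compact manifold, the tensor fields close to a metric in a smooth family are metrics. -/
lemma IsSmoothFamily.eventually_isMetric [CompactSpace M] (hU : IsOpen U) {c : W → SymTensor n M}
    (hc : IsSmoothFamily U c) {u : W} (hu : u ∈ U) (hm : IsMetric (c u)) :
    ∀ᶠ v in 𝓝 u, IsMetric (c v) := by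
  have h1 : ∀ᶠ v in 𝓝 u, ∀ x ∈ (univ : Set M), PosForm (c v x) := by
    refine isCompact_univ.eventually_forall_of_forall_eventually
      (P := fun v x => PosForm (c v x)) fun x _ => ?_
    have hx := mem_extChartAt_target (I := 𝓡 n) x
    have ho : IsOpen (U ×ˢ chartTarget n M x) := hU.prod (isOpen_chartTarget x)
    have h2 := ((isSmoothFamily_iff_rep hU).1 hc x).continuousOn.continuousAt
      (ho.mem_nhds (show (u, extChartAt (𝓡 n) x x) ∈ _ from ⟨hu, hx⟩))
    have h3 := h2.eventually (isOpen_posForm.mem_nhds (hm.rep_posForm hx))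
    have h4 : ContinuousAt (fun z : W × M => (z.1, extChartAt (𝓡 n) x z.2)) (u, x) :=
      continuousAt_fst.prodMk (ContinuousAt.comp (x := (u, x)) (f := Prod.snd)
        (g := extChartAt (𝓡 n) x) (continuousAt_extChartAt x) continuousAt_snd)
    have h5 : ∀ᶠ z : W × M in 𝓝 (u, x), z.2 ∈ (extChartAt (𝓡 n) x).source :=
      continuousAt_snd.eventually (extChartAt_source_mem_nhds x)
    filter_upwards [h4.eventually h3, h5] with z hz hz2 X hX
    obtain ⟨w, y⟩ := z
    obtain ⟨y', hy', rfl⟩ : ∃ y' ∈ chartTarget n M x, (extChartAt (𝓡 n) x).symm y' = y :=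
      ⟨_, (extChartAt (𝓡 n) x).map_source hz2, (extChartAt (𝓡 n) x).left_inv hz2⟩
    obtain ⟨T, hT, hT'⟩ := exists_chartFrame_equiv hy'
    simp only [(extChartAt (𝓡 n) x).right_inv hy'] at hz
    have h6 := hz (T.symm X) fun h0 => hX (by rw [← hT' X, h0, map_zero])
    rw [SymTensor.rep_apply, hT'] at h6
    exact h6
  exact h1.mono fun v hv x => hv x (mem_univ x)

end MetricVariation

/-! ### Hadamard's lemma for curves of tensor fields -/

section Hadamard

variable {n : ℕ} {M : Type*} [TopologicalSpace M] [ChartedSpace (EuclideanSpace ℝ (Fin n)) M]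
  [IsManifold (𝓡 n) ∞ M]

open MeasureTheory

lemma map_setIntegral {G : Type*} [NormedAddCommGroup G] [NormedSpace ℝ G] [CompleteSpace G]
    {f : ℝ → G} (hf : ContinuousOn f (Icc 0 1)) (L : G →L[ℝ] ℝ) :
    L (∫ θ in Icc (0 : ℝ) 1, f θ) = ∫ θ in Icc (0 : ℝ) 1, L (f θ) :=
  (L.integral_comp_comm (hf.integrableOn_compact isCompact_Icc)).symm

/-- Evaluation of bilinear forms at two vectors. -/
def evalCLM {F : Type*} [NormedAddCommGroup F] [NormedSpace ℝ F] (a b : F) :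
    (F →L[ℝ] F →L[ℝ] ℝ) →L[ℝ] ℝ where
  toFun B := B a b
  map_add' _ _ := rfl
  map_smul' _ _ := rfl
  cont := (contDiff_eval_eval (k := 0) a b).continuous

lemma setIntegral_eval_eval {f : ℝ → ModelForm n} (hf : ContinuousOn f (Icc 0 1))
    (a b : EuclideanSpace ℝ (Fin n)) :
    (∫ θ in Icc (0 : ℝ) 1, f θ) a b = ∫ θ in Icc (0 : ℝ) 1, f θ a b := by
  have h := map_setIntegral (G := ModelForm n) (f := f) hf (evalCLM a b)
  exact h

/-- The fundamental theorem of calculus in the form of Hadamard's lemma. -/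
lemma eq_add_mul_setIntegral {U : Set ℝ} {f f' : ℝ → ℝ} {t s : ℝ}
    (hmem : ∀ θ ∈ Icc (0 : ℝ) 1, t + θ * s ∈ U) (hf : ∀ τ ∈ U, HasDerivAt f (f' τ) τ)
    (hf' : ContinuousOn f' U) :
    f (t + s) = f t + s * ∫ θ in Icc (0 : ℝ) 1, f' (t + θ * s) := by
  have h1 : ∀ θ ∈ uIcc (0 : ℝ) 1, HasDerivAt (fun θ => f (t + θ * s)) (s * f' (t + θ * s)) θ := by
    intro θ hθ
    rw [uIcc_of_le zero_le_one] at hθ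
    have h3 : HasDerivAt (fun θ => t + θ * s) s θ := by
      simpa using ((hasDerivAt_id θ).mul_const s).const_add t
    rw [mul_comm]
    exact HasDerivAt.comp θ (hf _ (hmem θ hθ)) h3
  have h2 : ContinuousOn (fun θ => s * f' (t + θ * s)) (uIcc (0 : ℝ) 1) := by
    rw [uIcc_of_le zero_le_one]
    exact continuousOn_const.mul (hf'.comp (f := fun θ : ℝ => t + θ * s)
      (by fun_prop) fun θ hθ => hmem θ hθ)
  have h3 := intervalIntegral.integral_eq_sub_of_hasDerivAt h1 h2.intervalIntegrable
  rw [intervalIntegral.integral_const_mul, intervalIntegral.integral_of_le zero_le_one,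
    ← integral_Icc_eq_integral_Ioc] at h3
  simp only [one_mul, zero_mul, add_zero] at h3
  linarith

/-- The smooth family `s ↦ ∫₀¹ v(t + θ s) dθ`. -/
lemma exists_average {U V : Set ℝ} (hU : IsOpen U) (hV : IsOpen V) {v : ℝ → SymTensor n M}
    (hv : IsSmoothFamily U v) {t : ℝ} (hmem : ∀ θ ∈ Icc (0 : ℝ) 1, ∀ s ∈ V, t + θ * s ∈ U) :
    ∃ r : ℝ → SymTensor n M, IsSmoothFamily V r ∧ ∀ s ∈ V, ∀ x X Y,
      r s x X Y = ∫ θ in Icc (0 : ℝ) 1, v (t + θ * s) x X Y := by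
  have hcont : ContDiff ℝ ∞ (fun q : ℝ × (ℝ × EuclideanSpace ℝ (Fin n)) =>
      (t + q.1 * q.2.1, q.2.2)) := by fun_prop
  have hsm : ∀ p : M, ContDiffOn ℝ ∞ (fun q : ℝ × (ℝ × EuclideanSpace ℝ (Fin n)) =>
      (v (t + q.1 * q.2.1)).rep p q.2.2)
      ((fun q => (t + q.1 * q.2.1, q.2.2)) ⁻¹' (U ×ˢ chartTarget n M p)) := fun p =>
    ((isSmoothFamily_iff_rep hU).1 hv p).comp hcont.contDiffOn fun q hq => hq
  refine exists_family_of_eval hV (fun s x X Y => ∫ θ in Icc (0 : ℝ) 1, v (t + θ * s) x X Y)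
    (fun p q => ∫ θ in Icc (0 : ℝ) 1, (v (t + θ * q.1)).rep p q.2)
    (fun p => contDiffOn_setIntegral (hV.prod (isOpen_chartTarget p))
      ((hU.prod (isOpen_chartTarget p)).preimage hcont.continuous)
      (fun θ hθ z hz => ⟨hmem θ hθ z.1 hz.1, hz.2⟩) (hsm p))
    (fun s hs p y hy a b => ?_)
    (fun s hs x X Y => by simp only [(v _).symm x X Y])
  refine (setIntegral_eval_eval ?_ a b).trans rfl
  exact (hsm p).continuousOn.comp (f := fun θ : ℝ => (θ, (s, y)))
    (by fun_prop) fun θ hθ => ⟨hmem θ hθ s hs, hy⟩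

/-- Hadamard's lemma for curves of tensor fields: `c(t + s) = c(t) + s r(s)` with a smooth family
`r`, namely `r(s) = ∫₀¹ c'(t + θ s) dθ`. -/
lemma exists_hadamard {U : Set ℝ} (hU : IsOpen U) {c : ℝ → SymTensor n M}
    (hc : IsSmoothFamily U c) {t : ℝ} (ht : t ∈ U) :
    ∃ (ε : ℝ) (r : ℝ → SymTensor n M), 0 < ε ∧ IsSmoothFamily (Ioo (-ε) ε) r ∧
      (∀ s ∈ Ioo (-ε) ε, c (t + s) = c t + s • r s) ∧ r 0 = tensorDeriv c t := by
  obtain ⟨ε, hε, hb⟩ := Metric.isOpen_iff.1 hU t ht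
  have hmem : ∀ θ ∈ Icc (0 : ℝ) 1, ∀ s ∈ Ioo (-ε) ε, t + θ * s ∈ U := by
    intro θ hθ s hs
    apply hb
    rw [Metric.mem_ball, Real.dist_eq, add_sub_cancel_left, abs_mul, abs_of_nonneg hθ.1]
    have : |s| < ε := abs_lt.2 hs
    nlinarith [hθ.2, abs_nonneg s]
  have hv := hc.tensorDeriv hU
  obtain ⟨r, hr, hr'⟩ := exists_average hU isOpen_Ioo hv hmem
  refine ⟨ε, r, hε, hr, fun s hs => ?_, ?_⟩
  · ext x X Y
    refine (eq_add_mul_setIntegral (fun θ hθ => hmem θ hθ s hs)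
      (fun τ hτ => hc.hasTensorDerivAt hU hτ x X Y)
      (hv.contDiffOn_eval hU x X Y).continuousOn).trans ?_
    rw [← hr' s hs x X Y]
    rfl
  · ext x X Y
    rw [hr' 0 ⟨by linarith, hε⟩]
    simp

end Hadamard

/-! ### The operator `P` along families of metrics -/

section Operator

variable {n : ℕ} {M : Type*} [TopologicalSpace M] [ChartedSpace (EuclideanSpace ℝ (Fin n)) M]
  [IsManifold (𝓡 n) ∞ M]

section Families

variable {W : Type*} [NormedAddCommGroup W] [NormedSpace ℝ W] {U : Set W}

/-- The parameters `(u, s)` with `u ∈ U` for which `g(u) + s m(u)` is a metric. -/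
def lineDomain (U : Set W) (g m : W → SymTensor n M) : Set (W × ℝ) :=
  {q | q.1 ∈ U ∧ IsMetric (g q.1 + q.2 • m q.1)}

lemma isSmoothFamily_line (hU : IsOpen U) {g m : W → SymTensor n M} (hg : IsSmoothFamily U g)
    (hm : IsSmoothFamily U m) :
    IsSmoothFamily (U ×ˢ (univ : Set ℝ)) (fun q : W × ℝ => g q.1 + q.2 • m q.1) :=
  have ho : IsOpen (U ×ˢ (univ : Set ℝ)) := hU.prod isOpen_univ
  (hg.comp contDiff_fst.contDiffOn fun _ hq => hq.1).add ho
    ((hm.comp contDiff_fst.contDiffOn fun _ hq => hq.1).smul ho contDiff_snd.contDiffOn)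

lemma isOpen_lineDomain [CompactSpace M] (hU : IsOpen U) {g m : W → SymTensor n M}
    (hg : IsSmoothFamily U g) (hm : IsSmoothFamily U m) : IsOpen (lineDomain U g m) := by
  rw [isOpen_iff_mem_nhds]
  intro q hq
  have ho : IsOpen (U ×ˢ (univ : Set ℝ)) := hU.prod isOpen_univ
  have hq' : q ∈ U ×ˢ (univ : Set ℝ) := ⟨hq.1, mem_univ _⟩
  filter_upwards [(isSmoothFamily_line hU hg hm).eventually_isMetric ho hq' hq.2,
    ho.mem_nhds hq'] with z hz hz'
  exact ⟨hz'.1, hz⟩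

end Families

variable [T2Space M] [CompactSpace M]
  {P : SymTensor n M → SymTensor n M →ₗ[ℝ] SymTensor n M}

/-- The smoothness of `P`, evaluated on a family. -/
lemma IsMetricOperator.family (hP : IsMetricOperator P) {W : Type} [NormedAddCommGroup W]
    [NormedSpace ℝ W] [FiniteDimensional ℝ W] {U : Set W} (hU : IsOpen U) {g h : W → SymTensor n M}
    (hgm : ∀ u ∈ U, IsMetric (g u)) (hg : IsSmoothFamily U g) (hh : IsSmoothFamily U h) :
    IsSmoothFamily U (fun u => P (g u) (h u)) :=
  hP.smooth W U hU g h hgm hg hh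

/-- `(u, s) ↦ P_{g(u) + s m(u)} h(u)` is a smooth family. -/
lemma IsMetricOperator.family_line (hP : IsMetricOperator P) {W : Type} [NormedAddCommGroup W]
    [NormedSpace ℝ W] [FiniteDimensional ℝ W] {U : Set W} (hU : IsOpen U)
    {g m h : W → SymTensor n M} (hg : IsSmoothFamily U g) (hm : IsSmoothFamily U m)
    (hh : IsSmoothFamily U h) :
    IsSmoothFamily (lineDomain U g m)
      (fun q : W × ℝ => P (g q.1 + q.2 • m q.1) (h q.1)) :=
  hP.family (isOpen_lineDomain hU hg hm) (fun _ hq => hq.2)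
    ((isSmoothFamily_line hU hg hm).mono fun _ hq => ⟨hq.1, mem_univ _⟩)
    (hh.comp contDiff_fst.contDiffOn fun _ hq => hq.1)

lemma IsMetricOperator.family_derivP (hP : IsMetricOperator P) {W : Type} [NormedAddCommGroup W]
    [NormedSpace ℝ W] [FiniteDimensional ℝ W] {U : Set W} (hU : IsOpen U)
    {g m h : W → SymTensor n M} (hgm : ∀ u ∈ U, IsMetric (g u)) (hg : IsSmoothFamily U g)
    (hm : IsSmoothFamily U m) (hh : IsSmoothFamily U h) :
    IsSmoothFamily U (fun u => derivP P (g u) (m u) (h u)) := by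
  have h1 := (hP.family_line hU hg hm hh).dirDeriv (isOpen_lineDomain hU hg hm) ((0 : W), (1 : ℝ))
  have h2 := h1.comp (f := fun u : W => (u, (0 : ℝ))) (U' := U)
    (contDiff_id.prodMk contDiff_const).contDiffOn
    fun u hu => ⟨hu, by simpa using hgm u hu⟩
  refine h2.congr fun u hu => ?_
  simp [derivP, dirDeriv]

lemma IsMetricOperator.hasTensorDerivAt_derivP (hP : IsMetricOperator P) {g : SymTensor n M}
    (hg : IsMetric g) (m h : SymTensor n M) :
    HasTensorDerivAt (fun s : ℝ => P (g + s • m) h) (derivP P g m h) 0 := by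
  have h1 := hP.family_line (W := ℝ) isOpen_univ (isSmoothFamily_const univ g)
    (isSmoothFamily_const univ m) (isSmoothFamily_const univ h)
  have h2 := h1.hasTensorDerivAt_comp (isOpen_lineDomain isOpen_univ (isSmoothFamily_const univ g)
    (isSmoothFamily_const univ m)) (γ := fun s : ℝ => ((0 : ℝ), s)) (γ' := (0, 1)) (t := 0)
    ((hasDerivAt_const _ _).prodMk (hasDerivAt_id _)) ⟨mem_univ _, by simpa using hg⟩
  rw [derivP, h2.tensorDeriv_eq]
  exact h2

lemma IsMetricOperator.derivP_add_smul_right (hP : IsMetricOperator P) {g : SymTensor n M}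
    (hg : IsMetric g) (m h k : SymTensor n M) (r : ℝ) :
    derivP P g m (h + r • k) = derivP P g m h + r • derivP P g m k := by
  refine (hP.hasTensorDerivAt_derivP hg m (h + r • k)).unique fun x X Y => ?_
  have h1 := (hP.hasTensorDerivAt_derivP hg m h x X Y).add
    ((hP.hasTensorDerivAt_derivP hg m k x X Y).const_mul r)
  refine (h1.congr_of_eventuallyEq (.of_forall fun s => ?_)).congr_deriv rfl
  simp only [map_add, map_smul]
  rfl

/-- The derivative of `P` is linear in the direction: it is the derivative of the two-parameter
family `P_{g + s m + s' m'} h`. -/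
lemma IsMetricOperator.derivP_add_smul_left (hP : IsMetricOperator P) {g : SymTensor n M}
    (hg : IsMetric g) (m m' h : SymTensor n M) (r : ℝ) :
    derivP P g (m + r • m') h = derivP P g m h + r • derivP P g m' h := by
  have hl := isSmoothFamily_line (U := (univ : Set ℝ)) isOpen_univ (isSmoothFamily_const univ g)
    (isSmoothFamily_const univ m)
  have hc := isSmoothFamily_const (univ ×ˢ univ : Set (ℝ × ℝ)) m'
  have hU : IsOpen (univ ×ˢ univ : Set (ℝ × ℝ)) := isOpen_univ.prod isOpen_univ
  have hV := isOpen_lineDomain hU hl hc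
  have h1 := hP.family_line hU hl hc (isSmoothFamily_const _ h)
  have h0 : (((0 : ℝ), (0 : ℝ)), (0 : ℝ)) ∈ lineDomain (univ ×ˢ univ : Set (ℝ × ℝ))
      (fun q : ℝ × ℝ => g + q.2 • m) (fun _ => m') := ⟨by simp, by simpa using hg⟩
  have e1 := dirDeriv_add hV h1 h0 ((0, 1), 0) (r • ((0, 0), 1))
  rw [dirDeriv_smul hV h1 h0] at e1
  simpa [dirDeriv, derivP, mul_smul, smul_comm r, add_assoc] using e1

/-- The chain rule: `∂_t (P_{c(t)} h(t)) = (D_{(c, c_t)}P) h + P_c h_t`.  By Hadamard's lemma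
`c(t + s) = c(t) + s r(s)` and `h(t + s) = h(t) + s q(s)`, so that the curve is the restriction to
the diagonal of the two-parameter family `P_{c(t) + a r(b)} (h(t) + a q(b))`, which is constant in
`b` for `a = 0`. -/
lemma IsMetricOperator.hasTensorDerivAt_comp (hP : IsMetricOperator P) {J : Set ℝ} (hJ : IsOpen J)
    {c h : ℝ → SymTensor n M} (hcm : ∀ t ∈ J, IsMetric (c t)) (hc : IsSmoothFamily J c)
    (hh : IsSmoothFamily J h) {t : ℝ} (ht : t ∈ J) :
    HasTensorDerivAt (fun s => P (c s) (h s))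
      (derivP P (c t) (tensorDeriv c t) (h t) + P (c t) (tensorDeriv h t)) t := by
  obtain ⟨ε₁, r, hε₁, hr, hrs, hr0⟩ := exists_hadamard hJ hc ht
  obtain ⟨ε₂, q, hε₂, hq, hqs, hq0⟩ := exists_hadamard hJ hh ht
  have hε : 0 < min ε₁ ε₂ := lt_min hε₁ hε₂
  set ε := min ε₁ ε₂ with hεd
  have hr' : IsSmoothFamily (Ioo (-ε) ε) r :=
    hr.mono (Ioo_subset_Ioo (neg_le_neg (min_le_left _ _)) (min_le_left _ _))
  have hq' : IsSmoothFamily (Ioo (-ε) ε) q :=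
    hq.mono (Ioo_subset_Ioo (neg_le_neg (min_le_right _ _)) (min_le_right _ _))
  have hI : IsOpen (Ioo (-ε) ε) := isOpen_Ioo
  have hct := isSmoothFamily_const (Ioo (-ε) ε) (c t)
  have hV := isOpen_lineDomain hI hct hr'
  have hsub : lineDomain (Ioo (-ε) ε) (fun _ => c t) r ⊆ Ioo (-ε) ε ×ˢ univ :=
    fun z hz => ⟨hz.1, mem_univ _⟩
  have hF := hP.family hV (fun _ hz => hz.2) ((isSmoothFamily_line hI hct hr').mono hsub)
    ((isSmoothFamily_line hI (isSmoothFamily_const _ (h t)) hq').mono hsub)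
  set F : ℝ × ℝ → SymTensor n M := fun z => P (c t + z.2 • r z.1) (h t + z.2 • q z.1) with hFd
  have h0 : ((0 : ℝ), (0 : ℝ)) ∈ lineDomain (Ioo (-ε) ε) (fun _ => c t) r :=
    ⟨by simpa using hε, by simpa using hcm t ht⟩
  have hd := hF.hasTensorDerivAt_comp hV (γ := fun s : ℝ => (s, s)) (γ' := (1, 1)) (t := 0)
    ((hasDerivAt_id _).prodMk (hasDerivAt_id _)) h0
  have e1 : dirDeriv F ((0 : ℝ), (0 : ℝ)) ((1 : ℝ), (0 : ℝ)) = 0 := by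
    refine HasTensorDerivAt.tensorDeriv_eq fun x X Y => ?_
    simpa [hFd] using hasDerivAt_const (0 : ℝ) (P (c t) (h t) x X Y)
  have e2 : dirDeriv F ((0 : ℝ), (0 : ℝ)) ((0 : ℝ), (1 : ℝ)) =
      derivP P (c t) (tensorDeriv c t) (h t) + P (c t) (tensorDeriv h t) := by
    refine HasTensorDerivAt.tensorDeriv_eq fun x X Y => ?_
    have a1 := hP.hasTensorDerivAt_derivP (hcm t ht) (tensorDeriv c t) (h t) x X Y
    have a2 := hP.hasTensorDerivAt_derivP (hcm t ht) (tensorDeriv c t) (tensorDeriv h t) x X Y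
    have a3 := a1.add ((hasDerivAt_id (0 : ℝ)).mul a2)
    refine (a3.congr_of_eventuallyEq (.of_forall fun s => ?_)).congr_deriv ?_
    · simp only [hFd, Prod.smul_mk, Prod.mk_add_mk, smul_eq_mul, mul_zero, mul_one, zero_add,
        hr0, hq0, map_add, map_smul]
      rfl
    · simp
  have e3 : dirDeriv F ((0 : ℝ), (0 : ℝ)) ((1 : ℝ), (1 : ℝ)) =
      derivP P (c t) (tensorDeriv c t) (h t) + P (c t) (tensorDeriv h t) := by
    have := dirDeriv_add hV hF h0 (1, 0) (0, 1)
    rw [e1, e2, zero_add] at this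
    rw [← this]
    simp
  rw [e3] at hd
  -- shift the parameter from `0` to `t`
  intro x X Y
  have hd1 := hd x X Y
  rw [← sub_self t] at hd1
  refine (hd1.comp_sub_const t t).congr_of_eventuallyEq ?_
  have hev : ∀ᶠ s in 𝓝 t, s - t ∈ Ioo (-ε) ε := by
    have : Filter.Tendsto (fun s : ℝ => s - t) (𝓝 t) (𝓝 0) := by
      have h2 : Continuous fun s : ℝ => s - t := by fun_prop
      simpa using h2.tendsto t
    exact this.eventually (hI.mem_nhds (by simpa using hε))
  filter_upwards [hev] with s hs
  have hs1 : s - t ∈ Ioo (-ε₁) ε₁ :=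
    Ioo_subset_Ioo (neg_le_neg (min_le_left _ _)) (min_le_left _ _) hs
  have hs2 : s - t ∈ Ioo (-ε₂) ε₂ :=
    Ioo_subset_Ioo (neg_le_neg (min_le_right _ _)) (min_le_right _ _) hs
  have k1 := hrs _ hs1
  have k2 := hqs _ hs2
  rw [add_sub_cancel] at k1 k2
  simp only [hFd, ← k1, ← k2]

end Operator

/-! ### The `L²` product -/

section L2Product

open MeasureTheory

variable {n : ℕ} {M : Type*} [TopologicalSpace M] [ChartedSpace (EuclideanSpace ℝ (Fin n)) M]
  [IsManifold (𝓡 n) ∞ M]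

lemma localDensity_eq (g : SymTensor n M) {p : M} {y : EuclideanSpace ℝ (Fin n)}
    (hy : y ∈ chartTarget n M p) : localDensity g p y = Real.sqrt (gramDet (g.rep p y)) := by
  unfold localDensity gramDet
  simp only [SymTensor.rep_apply, chartFrame_eq_mfderiv hy]
  rfl

lemma g02_eq {g : SymTensor n M} (hg : IsMetric g) (h k : SymTensor n M) {p : M}
    {y : EuclideanSpace ℝ (Fin n)} (hy : y ∈ chartTarget n M p) :
    g02 (g ((extChartAt (𝓡 n) p).symm y)) (h ((extChartAt (𝓡 n) p).symm y))
      (k ((extChartAt (𝓡 n) p).symm y)) = g02B (g.rep p y) (h.rep p y) (k.rep p y) := by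
  obtain ⟨T, hT, -⟩ := exists_chartFrame_equiv hy
  simp only [SymTensor.rep, fieldRep, ← hT]
  exact (g02B_pullB T (hg.isInvertible _) _ _).symm

variable [T2Space M] [CompactSpace M]

/-- The function of the partition of unity with index `p`, in coordinates. -/
def chartWeight (p : M) (y : EuclideanSpace ℝ (Fin n)) : ℝ :=
  chartPartition n M p ((extChartAt (𝓡 n) p).symm y)

variable (n) in
/-- A compact subset of the chart domain outside of which `chartWeight p` vanishes. -/
def chartCompact (p : M) : Set (EuclideanSpace ℝ (Fin n)) :=
  extChartAt (𝓡 n) p '' tsupport (chartPartition n M p)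

lemma tsupport_chartPartition_subset (p : M) :
    tsupport (chartPartition n M p) ⊆ (extChartAt (𝓡 n) p).source := by
  rw [extChartAt_source]
  exact (exists_chart_partition n M).choose_spec p

lemma isCompact_chartCompact (p : M) : IsCompact (chartCompact n p) :=
  (isClosed_tsupport _).isCompact.image_of_continuousOn
    ((continuousOn_extChartAt p).mono (tsupport_chartPartition_subset p))

lemma chartCompact_subset (p : M) : chartCompact n p ⊆ chartTarget n M p := by
  rintro _ ⟨x, hx, rfl⟩
  exact (extChartAt (𝓡 n) p).map_source (tsupport_chartPartition_subset p hx)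

lemma chartWeight_eq_zero {p : M} {y : EuclideanSpace ℝ (Fin n)}
    (hy : y ∈ chartTarget n M p \ chartCompact n p) : chartWeight p y = 0 := by
  by_contra h
  exact hy.2 ⟨_, subset_tsupport _ h, (extChartAt (𝓡 n) p).right_inv hy.1⟩

lemma continuousOn_chartWeight (p : M) :
    ContinuousOn (chartWeight (n := n) p) (chartTarget n M p) :=
  (chartPartition n M p).contMDiff.continuous.comp_continuousOn (continuousOn_extChartAt_symm p)

variable (n M) in
lemma finite_chartPartition : {p : M | (Function.support (chartPartition n M p)).Nonempty}.Finite :=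
  (chartPartition n M).locallyFinite.finite_nonempty_of_compact

variable (n M) in
/-- The finitely many indices of the partition of unity that matter. -/
def chartIndex : Finset M := (finite_chartPartition n M).toFinset

/-- The `L²` product as a finite sum of integrals over compact sets in the charts. -/
lemma tensorL2_eq_sum {g : SymTensor n M} (hg : IsMetric g) (h k : SymTensor n M) :
    tensorL2 g h k = ∑ p ∈ chartIndex n M, ∫ y in chartCompact n p,
      chartWeight p y * pairingDensity (g.rep p y) (h.rep p y) (k.rep p y) := by
  rw [tensorL2, volIntegral, finsum_eq_sum_of_support_subset (s := chartIndex n M)]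
  · refine Finset.sum_congr rfl fun p _ => ?_
    rw [← setIntegral_eq_of_subset_of_forall_sdiff_eq_zero (isOpen_chartTarget p).measurableSet
      (chartCompact_subset p)]
    · refine setIntegral_congr_fun (isOpen_chartTarget p).measurableSet fun y hy => ?_
      simp only [g02_eq hg h k hy, localDensity_eq g hy, pairingDensity, chartWeight, mul_assoc]
    · intro y hy
      rw [chartWeight_eq_zero hy, zero_mul]
  · intro p hp
    by_contra h
    refine hp ?_
    have h0 : ∀ x, chartPartition n M p x = 0 := by
      intro x
      by_contra hx
      exact h ((finite_chartPartition n M).mem_toFinset.2 ⟨x, hx⟩)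
    simp [h0]

section Families

variable {W : Type*} [NormedAddCommGroup W] [NormedSpace ℝ W] {U : Set W}
  {g h k : W → SymTensor n M}

lemma continuousOn_pairing (hU : IsOpen U) (hgm : ∀ u ∈ U, IsMetric (g u))
    (hg : IsSmoothFamily U g) (hh : IsSmoothFamily U h) (hk : IsSmoothFamily U k) (p : M) :
    ContinuousOn (fun q : W × EuclideanSpace ℝ (Fin n) => chartWeight p q.2 *
      pairingDensity ((g q.1).rep p q.2) ((h q.1).rep p q.2) ((k q.1).rep p q.2))
      (U ×ˢ chartCompact n p) := by
  have hsub : U ×ˢ chartCompact n p ⊆ U ×ˢ chartTarget n M p :=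
    prod_mono le_rfl (chartCompact_subset p)
  rw [isSmoothFamily_iff_rep hU] at hg hh hk
  exact ((continuousOn_chartWeight p).comp continuous_snd.continuousOn
    fun q hq => (hsub hq).2).mul (continuousOn_pairingDensity ((hg p).continuousOn.mono hsub)
      (fun q hq => (hgm q.1 hq.1).rep_isInvertible (hsub hq).2) ((hh p).continuousOn.mono hsub)
      ((hk p).continuousOn.mono hsub))

/-- The `L²` product of smooth families is continuous. -/
lemma continuousOn_tensorL2 (hU : IsOpen U) (hgm : ∀ u ∈ U, IsMetric (g u))
    (hg : IsSmoothFamily U g) (hh : IsSmoothFamily U h) (hk : IsSmoothFamily U k) :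
    ContinuousOn (fun u => tensorL2 (g u) (h u) (k u)) U := by
  have h1 : ContinuousOn (fun u => ∑ p ∈ chartIndex n M, ∫ y in chartCompact n p,
      chartWeight p y * pairingDensity ((g u).rep p y) ((h u).rep p y) ((k u).rep p y)) U :=
    continuousOn_finsetSum _ fun p _ => continuousOn_setIntegral_of_compact
      (isCompact_chartCompact p) hU (continuousOn_pairing hU hgm hg hh hk p)
  exact h1.congr fun u hu => tensorL2_eq_sum (hgm u hu) _ _

end Families

lemma integrableOn_pairing {g : SymTensor n M} (hg : IsMetric g) (h k : SymTensor n M) (p : M) :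
    IntegrableOn (fun y => chartWeight p y *
      pairingDensity (g.rep p y) (h.rep p y) (k.rep p y)) (chartCompact n p) :=
  integrableOn_slice (V := (univ : Set ℝ)) (u := 0) (isCompact_chartCompact p)
    (f := fun _ y => chartWeight p y * pairingDensity (g.rep p y) (h.rep p y) (k.rep p y))
    (continuousOn_pairing isOpen_univ (fun _ _ => hg) (isSmoothFamily_const _ g)
      (isSmoothFamily_const _ h) (isSmoothFamily_const _ k) p) (mem_univ _)

lemma tensorL2_comm (g h k : SymTensor n M) : tensorL2 g h k = tensorL2 g k h := by
  unfold tensorL2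
  congr 1
  funext x
  exact g02B_comm _ _ _

lemma tensorL2_add_smul_left {g : SymTensor n M} (hg : IsMetric g) (h h' k : SymTensor n M)
    (r : ℝ) : tensorL2 g (h + r • h') k = tensorL2 g h k + r * tensorL2 g h' k := by
  simp only [tensorL2_eq_sum hg, Finset.mul_sum]
  rw [← Finset.sum_add_distrib]
  refine Finset.sum_congr rfl fun p _ => ?_
  rw [← integral_const_mul, ← integral_add (integrableOn_pairing hg h k p)
    ((integrableOn_pairing hg h' k p).const_mul r)]
  congr 1
  funext y
  simp only [pairingDensity, SymTensor.rep_add, SymTensor.rep_smul]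
  rw [g02B_add_left, g02B_smul_left]
  ring

lemma tensorL2_add_left {g : SymTensor n M} (hg : IsMetric g) (h h' k : SymTensor n M) :
    tensorL2 g (h + h') k = tensorL2 g h k + tensorL2 g h' k := by
  simpa using tensorL2_add_smul_left hg h h' k 1

lemma tensorL2_add_right {g : SymTensor n M} (hg : IsMetric g) (h k k' : SymTensor n M) :
    tensorL2 g h (k + k') = tensorL2 g h k + tensorL2 g h k' := by
  rw [tensorL2_comm, tensorL2_add_left hg, tensorL2_comm g k, tensorL2_comm g k']

lemma tensorL2_sub_left {g : SymTensor n M} (hg : IsMetric g) (h h' k : SymTensor n M) :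
    tensorL2 g (h - h') k = tensorL2 g h k - tensorL2 g h' k := by
  have := tensorL2_add_smul_left hg h h' k (-1)
  rw [neg_one_smul, ← sub_eq_add_neg] at this
  linarith

lemma tensorL2_smul_left {g : SymTensor n M} (hg : IsMetric g) (h k : SymTensor n M) (r : ℝ) :
    tensorL2 g (r • h) k = r * tensorL2 g h k := by
  have h0 : tensorL2 g 0 k = 0 := by simpa using tensorL2_sub_left hg 0 0 k
  simpa [h0] using tensorL2_add_smul_left hg 0 h k r

/-- The variation of the `L²` product with the metric and its adjoint. -/
lemma tensorL2_metricVar {g : SymTensor n M} (hg : IsMetric g) (m h k : SymTensor n M) :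
    tensorL2 g (metricVar g m h) k = tensorL2 g m (metricVarAdj g h k) := by
  unfold tensorL2
  congr 1
  funext x
  rw [metricVar_apply hg, metricVarAdj_apply hg]
  exact g02B_metricVarB (hg.isInvertible x) _ _ _

/-- The derivative of the `L²` product along curves. -/
lemma hasDerivAt_tensorL2 {U : Set ℝ} (hU : IsOpen U) {g h k : ℝ → SymTensor n M}
    (hgm : ∀ u ∈ U, IsMetric (g u)) (hg : IsSmoothFamily U g) (hh : IsSmoothFamily U h)
    (hk : IsSmoothFamily U k) {t : ℝ} (ht : t ∈ U) :
    HasDerivAt (fun s => tensorL2 (g s) (h s) (k s))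
      (tensorL2 (g t) (tensorDeriv h t + metricVar (g t) (tensorDeriv g t) (h t)) (k t) +
        tensorL2 (g t) (h t) (tensorDeriv k t)) t := by
  have hg' := hg.tensorDeriv hU
  have hh' := hh.tensorDeriv hU
  have hk' := hk.tensorDeriv hU
  have hX := hh'.add hU (IsSmoothFamily.metricVar hU hgm hg hg' hh)
  have h1 : ∀ p ∈ chartIndex n M, HasDerivAt (fun s => ∫ y in chartCompact n p,
      chartWeight p y * pairingDensity ((g s).rep p y) ((h s).rep p y) ((k s).rep p y))
      (∫ y in chartCompact n p,
        (chartWeight p y * pairingDensity ((g t).rep p y)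
          ((tensorDeriv h t + metricVar (g t) (tensorDeriv g t) (h t)).rep p y) ((k t).rep p y) +
        chartWeight p y * pairingDensity ((g t).rep p y) ((h t).rep p y)
          ((tensorDeriv k t).rep p y))) t := by
    intro p _
    refine hasDerivAt_setIntegral_of_compact (isCompact_chartCompact p) hU
      (f := fun s y => chartWeight p y *
        pairingDensity ((g s).rep p y) ((h s).rep p y) ((k s).rep p y))
      (f' := fun t y => chartWeight p y * pairingDensity ((g t).rep p y)
          ((tensorDeriv h t + metricVar (g t) (tensorDeriv g t) (h t)).rep p y) ((k t).rep p y) +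
        chartWeight p y * pairingDensity ((g t).rep p y) ((h t).rep p y)
          ((tensorDeriv k t).rep p y))
      (continuousOn_pairing hU hgm hg hh hk p)
      ((continuousOn_pairing hU hgm hg hX hk p).add (continuousOn_pairing hU hgm hg hh hk' p))
      (fun s hs y hy => ?_) ht
    have hy' := chartCompact_subset p hy
    have h2 := hasDerivAt_pairingDensity
      (hg.hasDerivAt_rep hU hs (hg.hasTensorDerivAt hU hs) hy')
      (hh.hasDerivAt_rep hU hs (hh.hasTensorDerivAt hU hs) hy')
      (hk.hasDerivAt_rep hU hs (hk.hasTensorDerivAt hU hs) hy')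
      ((hgm s hs).rep_isInvertible hy')
    rw [← mul_add, SymTensor.rep_add, metricVar_rep (hgm s hs) _ _ hy']
    exact h2.const_mul _
  have h2 := HasDerivAt.fun_sum h1
  simp only [integral_add (integrableOn_pairing (hgm t ht) _ _ _)
    (integrableOn_pairing (hgm t ht) _ _ _), Finset.sum_add_distrib,
    ← tensorL2_eq_sum (hgm t ht)] at h2
  refine h2.congr_of_eventuallyEq ?_
  filter_upwards [hU.mem_nhds ht] with s hs
  exact tensorL2_eq_sum (hgm s hs) _ _

end L2Product

/-! ### The metric gradients -/

section Gradients

variable {n : ℕ} {M : Type*} [TopologicalSpace M] [ChartedSpace (EuclideanSpace ℝ (Fin n)) M]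
  [IsManifold (𝓡 n) ∞ M]

lemma metricVar_add_smul {g : SymTensor n M} (hg : IsMetric g) (m h k : SymTensor n M) (r : ℝ) :
    metricVar g m (h + r • k) = metricVar g m h + r • metricVar g m k ∧
    metricVar g (h + r • k) m = metricVar g h m + r • metricVar g k m ∧
    metricVarAdj g m (h + r • k) = metricVarAdj g m h + r • metricVarAdj g m k ∧
    metricVarAdj g (h + r • k) m = metricVarAdj g h m + r • metricVarAdj g k m := by
  refine ⟨?_, ?_, ?_, ?_⟩ <;>
  · refine SymTensor.ext fun x => ?_
    have := metricVarB_add_smul (g x) (m x) (h x) (k x) r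
    simp only [SymTensor.add_apply, SymTensor.smul_apply, metricVar_apply hg,
      metricVarAdj_apply hg, this]

lemma isLinearMap_of_add_smul {V V' : Type*} [AddCommGroup V] [Module ℝ V] [AddCommGroup V']
    [Module ℝ V'] {f : V → V'} (hf : ∀ x y (r : ℝ), f (x + r • y) = f x + r • f y) :
    IsLinearMap ℝ f := by
  have h0 : f 0 = 0 := by
    have := hf 0 0 1
    simpa using this
  exact ⟨fun x y => by simpa using hf x y 1, fun r x => by simpa [h0] using hf 0 x r⟩

variable {P : SymTensor n M → SymTensor n M →ₗ[ℝ] SymTensor n M}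

/-- `P_g K_g(h, m)`, where `K` is the first metric gradient. -/
def gradKForm (P : SymTensor n M → SymTensor n M →ₗ[ℝ] SymTensor n M) (g h m : SymTensor n M) :
    SymTensor n M :=
  derivP P g m h + metricVar g m (P g h)

/-- `P_g H_g(h, k)`, where `H` is the second metric gradient and `A` the adjoint of the derivative
of `P`. -/
def gradHForm (P : SymTensor n M → SymTensor n M →ₗ[ℝ] SymTensor n M)
    (A : SymTensor n M → SymTensor n M → SymTensor n M → SymTensor n M) (g h k : SymTensor n M) :
    SymTensor n M :=
  A g h k + metricVarAdj g (P g h) k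

lemma gradKForm_apply {g : SymTensor n M} (hg : IsMetric g) (h m : SymTensor n M) (x : M) :
    gradKForm P g h m x = -sandwich (g x) (m x) (P g h x) + derivP P g m h x
      - sandwich (g x) (P g h x) (m x) + (1 / 2 * traceForm (g x) (m x)) • P g h x := by
  rw [gradKForm, SymTensor.add_apply, metricVar_apply hg]
  change _ + ((-1 : ℝ) • (sandwich (g x) (m x) (P g h x) + sandwich (g x) (P g h x) (m x)) +
    (1 / 2 * traceForm (g x) (m x)) • P g h x) = _
  module

lemma gradHForm_apply {A : SymTensor n M → SymTensor n M → SymTensor n M → SymTensor n M}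
    {g : SymTensor n M} (hg : IsMetric g) (h k : SymTensor n M) (x : M) :
    gradHForm P A g h k x = A g h k x - sandwich (g x) (P g h x) (k x)
      - sandwich (g x) (k x) (P g h x) + (1 / 2 * g02 (g x) (P g h x) (k x)) • g x := by
  rw [gradHForm, SymTensor.add_apply, metricVarAdj_apply hg]
  change _ + ((-1 : ℝ) • (sandwich (g x) (P g h x) (k x) + sandwich (g x) (k x) (P g h x)) +
    (1 / 2 * g02 (g x) (P g h x) (k x)) • g x) = _
  module

variable [T2Space M] [CompactSpace M]

/-- The `L²` product is nondegenerate, because `P` is positive and surjective. -/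
lemma IsMetricOperator.eq_of_tensorL2_left (hP : IsMetricOperator P) {g : SymTensor n M}
    (hg : IsMetric g) {a b : SymTensor n M} (h : ∀ k, tensorL2 g a k = tensorL2 g b k) : a = b := by
  obtain ⟨e, he⟩ := (hP.bij g hg).2 (a - b)
  have h1 : tensorL2 g (P g e) e = 0 := by rw [he, tensorL2_sub_left hg, h e, sub_self]
  have h2 : e = 0 := by
    by_contra h0
    exact (hP.pos g hg e h0).ne' h1
  rw [h2, map_zero] at he
  exact (sub_eq_zero.1 he.symm)

/-- The derivative of `G^P` along curves. -/
lemma IsMetricOperator.hasDerivAt_GP (hP : IsMetricOperator P) {U : Set ℝ} (hU : IsOpen U)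
    {g h k : ℝ → SymTensor n M} (hgm : ∀ u ∈ U, IsMetric (g u)) (hg : IsSmoothFamily U g)
    (hh : IsSmoothFamily U h) (hk : IsSmoothFamily U k) {t : ℝ} (ht : t ∈ U) :
    HasDerivAt (fun s => GP P (g s) (h s) (k s))
      (tensorL2 (g t) (derivP P (g t) (tensorDeriv g t) (h t) + P (g t) (tensorDeriv h t) +
          metricVar (g t) (tensorDeriv g t) (P (g t) (h t))) (k t) +
        tensorL2 (g t) (P (g t) (h t)) (tensorDeriv k t)) t := by
  have h1 := hasDerivAt_tensorL2 hU hgm hg (hP.family hU hgm hg hh) hk ht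
  rwa [(hP.hasTensorDerivAt_comp hU hgm hg hh ht).tensorDeriv_eq] at h1

lemma IsMetricOperator.hasDerivAt_GP_line (hP : IsMetricOperator P) {g : SymTensor n M}
    (hg : IsMetric g) (m h k : SymTensor n M) :
    HasDerivAt (fun s : ℝ => GP P (g + s • m) h k) (tensorL2 g (gradKForm P g h m) k) 0 := by
  have hl : IsSmoothFamily (univ : Set ℝ) (fun s : ℝ => g + s • m) :=
    (isSmoothFamily_const univ g).add isOpen_univ
      ((isSmoothFamily_const univ m).smul isOpen_univ contDiffOn_id)
  have hV : IsOpen {s : ℝ | IsMetric (g + s • m)} := by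
    rw [isOpen_iff_mem_nhds]
    exact fun s hs => hl.eventually_isMetric isOpen_univ (mem_univ s) hs
  have h0 : (0 : ℝ) ∈ {s : ℝ | IsMetric (g + s • m)} := by simpa using hg
  have h1 := hP.hasDerivAt_GP hV (fun _ hs => hs) (hl.mono (subset_univ _))
    (isSmoothFamily_const _ h) (isSmoothFamily_const _ k) h0
  have e1 : tensorDeriv (fun s : ℝ => g + s • m) 0 = m := by
    refine HasTensorDerivAt.tensorDeriv_eq fun x X Y => ?_
    have := ((hasDerivAt_id (0 : ℝ)).mul_const (m x X Y)).const_add (g x X Y)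
    rw [one_mul] at this
    exact this
  have e2 : ∀ k : SymTensor n M, tensorDeriv (fun _ : ℝ => k) 0 = 0 := fun k =>
    HasTensorDerivAt.tensorDeriv_eq fun x X Y => hasDerivAt_const _ _
  have e3 : tensorL2 g (P g h) 0 = 0 := by
    rw [tensorL2_comm]
    simpa using tensorL2_smul_left hg 0 (P g h) 0
  simpa [e1, e2, e3, gradKForm] using h1

lemma IsMetricOperator.isGradientK_iff (hP : IsMetricOperator P)
    (K : SymTensor n M → SymTensor n M → SymTensor n M → SymTensor n M) :
    IsGradientK P K ↔ ∀ g, IsMetric g → ∀ h m, P g (K g h m) = gradKForm P g h m := by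
  refine ⟨fun hK g hg h m => hP.eq_of_tensorL2_left hg fun k => ?_, fun hK g hg m h k => ?_⟩
  · exact (hK g hg m h k).unique (hP.hasDerivAt_GP_line hg m h k)
  · rw [GP, hK g hg]
    exact hP.hasDerivAt_GP_line hg m h k

/-- The derivative of `G^P` in the direction `m` as an `L²` product with `m`. -/
lemma IsDerivAdjoint.tensorL2_gradKForm
    {A : SymTensor n M → SymTensor n M → SymTensor n M → SymTensor n M} (hA : IsDerivAdjoint P A)
    {g : SymTensor n M} (hg : IsMetric g) (m h k : SymTensor n M) :
    tensorL2 g (gradKForm P g h m) k = tensorL2 g m (gradHForm P A g h k) := by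
  rw [gradKForm, gradHForm, tensorL2_add_left hg, tensorL2_add_right hg, hA.adjoint g hg,
    tensorL2_metricVar hg]

lemma IsMetricOperator.isGradientH_iff (hP : IsMetricOperator P)
    {A : SymTensor n M → SymTensor n M → SymTensor n M → SymTensor n M} (hA : IsDerivAdjoint P A)
    (H : SymTensor n M → SymTensor n M → SymTensor n M → SymTensor n M) :
    IsGradientH P H ↔ ∀ g, IsMetric g → ∀ h k, P g (H g h k) = gradHForm P A g h k := by
  have hD : ∀ g, IsMetric g → ∀ m h k,
      HasDerivAt (fun s : ℝ => GP P (g + s • m) h k) (tensorL2 g m (gradHForm P A g h k)) 0 :=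
    fun g hg m h k => hA.tensorL2_gradKForm hg m h k ▸ hP.hasDerivAt_GP_line hg m h k
  refine ⟨fun hH g hg h k => hP.eq_of_tensorL2_left hg fun m => ?_, fun hH g hg m h k => ?_⟩
  · rw [tensorL2_comm, tensorL2_comm g _ m, ← hP.symm g hg]
    exact (hH g hg m h k).unique (hD g hg m h k)
  · rw [GP, hP.symm g hg, hH g hg]
    exact hD g hg m h k

/-- Applying `P⁻¹` to a bilinear family gives a bilinear family. -/
lemma IsMetricOperator.exists_bilinear (hP : IsMetricOperator P)
    {B : SymTensor n M → SymTensor n M → SymTensor n M → SymTensor n M} (hB : IsBilinear B) :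
    ∃ K, (∀ g, IsMetric g → ∀ h m, P g (K g h m) = B g h m) ∧ IsBilinear K := by
  have h1 : ∀ g h m, ∃ k, IsMetric g → P g k = B g h m := by
    intro g h m
    by_cases hg : IsMetric g
    · obtain ⟨k, hk⟩ := (hP.bij g hg).2 (B g h m)
      exact ⟨k, fun _ => hk⟩
    · exact ⟨0, fun h => absurd h hg⟩
  choose K hK using h1
  refine ⟨K, fun g hg h m => hK g h m hg, fun g hg => ⟨fun h => ?_, fun m => ?_⟩⟩
  · refine isLinearMap_of_add_smul fun x y r => (hP.bij g hg).1 ?_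
    rw [map_add, map_smul, hK g _ _ hg, hK g _ _ hg, hK g _ _ hg, ((hB g hg).1 h).map_add,
      ((hB g hg).1 h).map_smul]
  · refine isLinearMap_of_add_smul fun x y r => (hP.bij g hg).1 ?_
    rw [map_add, map_smul, hK g _ _ hg, hK g _ _ hg, hK g _ _ hg, ((hB g hg).2 m).map_add,
      ((hB g hg).2 m).map_smul]

lemma IsMetricOperator.isBilinear_gradKForm (hP : IsMetricOperator P) :
    IsBilinear (gradKForm P) := by
  refine fun g hg => ⟨fun h => isLinearMap_of_add_smul fun x y r => ?_,
    fun m => isLinearMap_of_add_smul fun x y r => ?_⟩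
  · simp only [gradKForm, hP.derivP_add_smul_left hg, (metricVar_add_smul hg _ _ _ _).2.1]
    module
  · simp only [gradKForm, hP.derivP_add_smul_right hg, map_add, map_smul,
      (metricVar_add_smul hg _ _ _ _).1]
    module

lemma IsDerivAdjoint.isBilinear_gradHForm
    {A : SymTensor n M → SymTensor n M → SymTensor n M → SymTensor n M}
    (hA : IsDerivAdjoint P A) : IsBilinear (gradHForm P A) := by
  refine fun g hg => ⟨fun h => isLinearMap_of_add_smul fun x y r => ?_,
    fun m => isLinearMap_of_add_smul fun x y r => ?_⟩
  · simp only [gradHForm, ((hA.bilin g hg).1 h).map_add, ((hA.bilin g hg).1 h).map_smul,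
      (metricVar_add_smul hg _ _ _ _).2.2.1]
    module
  · simp only [gradHForm, ((hA.bilin g hg).2 m).map_add, ((hA.bilin g hg).2 m).map_smul,
      map_add, map_smul, (metricVar_add_smul hg _ _ _ _).2.2.2]
    module

lemma IsMetricOperator.isSmooth_gradKForm (hP : IsMetricOperator P) : IsSmooth₃ (gradKForm P) :=
  fun _ _ _ _ _ hU _ _ _ hgm hg hh hm =>
    (hP.family_derivP hU hgm hg hm hh).add hU
      (IsSmoothFamily.metricVar hU hgm hg hm (hP.family hU hgm hg hh))

lemma IsMetricOperator.isSmooth_gradHForm (hP : IsMetricOperator P)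
    {A : SymTensor n M → SymTensor n M → SymTensor n M → SymTensor n M}
    (hA : IsDerivAdjoint P A) : IsSmooth₃ (gradHForm P A) :=
  fun W _ _ _ U hU g h k hgm hg hh hk =>
    (hA.smooth W U hU g h k hgm hg hh hk).add hU
      (IsSmoothFamily.metricVarAdj hU hgm hg (hP.family hU hgm hg hh) hk)

/-- Applying `P⁻¹` to a smooth family gives a smooth family, if `P⁻¹` is smooth. -/
lemma IsMetricOperator.isSmooth_of_inverse (hP : IsMetricOperator P)
    {Q : SymTensor n M → SymTensor n M → SymTensor n M}
    (hQ : ∀ g, IsMetric g → ∀ h, P g (Q g h) = h) (hQs : IsSmooth₂ Q)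
    {B K : SymTensor n M → SymTensor n M → SymTensor n M → SymTensor n M} (hB : IsSmooth₃ B)
    (hK : ∀ g, IsMetric g → ∀ h m, P g (K g h m) = B g h m) : IsSmooth₃ K := by
  intro W _ _ _ U hU g h m hgm hg hh hm
  refine (hQs W U hU g (fun u => B (g u) (h u) (m u)) hgm hg
    (hB W U hU g h m hgm hg hh hm)).congr fun u hu => (hP.bij _ (hgm u hu)).1 ?_
  rw [hK _ (hgm u hu), hQ _ (hgm u hu)]

end Gradients

/-! ### The first variation of the energy -/

section Geodesics

variable {n : ℕ} {M : Type*} [TopologicalSpace M] [ChartedSpace (EuclideanSpace ℝ (Fin n)) M]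
  [IsManifold (𝓡 n) ∞ M]

/-- Second directional derivatives of a smooth family commute. -/
lemma dirDeriv_comm {W : Type*} [NormedAddCommGroup W] [NormedSpace ℝ W] {U : Set W}
    (hU : IsOpen U) {c : W → SymTensor n M} (hc : IsSmoothFamily U c) {u : W} (hu : u ∈ U)
    (e e' : W) :
    dirDeriv (fun p => dirDeriv c p e) u e' = dirDeriv (fun p => dirDeriv c p e') u e := by
  ext x X Y
  rw [dirDeriv_apply hU (hc.dirDeriv hU e) hu, dirDeriv_apply hU (hc.dirDeriv hU e') hu]
  have hf : ContDiffAt ℝ ∞ (fun u => c u x X Y) u :=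
    (hc.contDiffOn_eval hU x X Y).contDiffAt (hU.mem_nhds hu)
  have hd : DifferentiableAt ℝ (fderiv ℝ (fun u => c u x X Y)) u :=
    (hf.fderiv_right (m := ∞) (by simp)).differentiableAt (by simp)
  have key : ∀ e e' : W, fderiv ℝ (fun p => dirDeriv c p e x X Y) u e' =
      fderiv ℝ (fderiv ℝ (fun u => c u x X Y)) u e' e := by
    intro e e'
    have h1 : (fun p => dirDeriv c p e x X Y) =ᶠ[𝓝 u]
        fun p => fderiv ℝ (fun u => c u x X Y) p e := by
      filter_upwards [hU.mem_nhds hu] with p hp using dirDeriv_apply hU hc hp e x X Y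
    rw [h1.fderiv_eq, (hd.hasFDerivAt.clm_apply (hasFDerivAt_const e u)).fderiv]
    simp
  rw [key, key]
  exact ((contDiffAt_infty.1 hf 2).isSymmSndFDerivAt (by simp)).eq e' e

variable {I J : Set ℝ}

lemma hasTensorDerivAt_fst (hI : IsOpen I) (hJ : IsOpen J) {w : ℝ × ℝ → SymTensor n M}
    (hw : IsSmoothFamily (I ×ˢ J) w) {s t : ℝ} (hs : s ∈ I) (ht : t ∈ J) :
    HasTensorDerivAt (fun s => w (s, t)) (dirDeriv w (s, t) (1, 0)) s :=
  hw.hasTensorDerivAt_comp (hI.prod hJ) (γ := fun s => (s, t))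
    ((hasDerivAt_id s).prodMk (hasDerivAt_const s t)) ⟨hs, ht⟩

lemma hasTensorDerivAt_snd (hI : IsOpen I) (hJ : IsOpen J) {w : ℝ × ℝ → SymTensor n M}
    (hw : IsSmoothFamily (I ×ˢ J) w) {s t : ℝ} (hs : s ∈ I) (ht : t ∈ J) :
    HasTensorDerivAt (fun t => w (s, t)) (dirDeriv w (s, t) (0, 1)) t :=
  hw.hasTensorDerivAt_comp (hI.prod hJ) (γ := fun t => (s, t))
    ((hasDerivAt_const t s).prodMk (hasDerivAt_id t)) ⟨hs, ht⟩

lemma isSmoothFamily_fst {w : ℝ × ℝ → SymTensor n M}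
    (hw : IsSmoothFamily (I ×ˢ J) w) {t : ℝ} (ht : t ∈ J) :
    IsSmoothFamily I (fun s => w (s, t)) :=
  hw.comp (f := fun s => (s, t)) (contDiff_id.prodMk contDiff_const).contDiffOn
    fun _ hs => ⟨hs, ht⟩

lemma isSmoothFamily_snd {w : ℝ × ℝ → SymTensor n M}
    (hw : IsSmoothFamily (I ×ˢ J) w) {s : ℝ} (hs : s ∈ I) :
    IsSmoothFamily J (fun t => w (s, t)) :=
  hw.comp (f := fun t => (s, t)) (contDiff_const.prodMk contDiff_id).contDiffOn
    fun _ ht => ⟨hs, ht⟩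

variable [T2Space M] [CompactSpace M] {P : SymTensor n M → SymTensor n M →ₗ[ℝ] SymTensor n M}
  {A : SymTensor n M → SymTensor n M → SymTensor n M → SymTensor n M}

/-- The residual `P_c(½ H_c(c_t, c_t) - K_c(c_t, c_t) - c_tt)` of the geodesic equation. -/
def geodesicResidual (P : SymTensor n M → SymTensor n M →ₗ[ℝ] SymTensor n M)
    (A : SymTensor n M → SymTensor n M → SymTensor n M → SymTensor n M) (c : ℝ → SymTensor n M)
    (t : ℝ) : SymTensor n M :=
  (1 / 2 : ℝ) • gradHForm P A (c t) (tensorDeriv c t) (tensorDeriv c t) -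
    (gradKForm P (c t) (tensorDeriv c t) (tensorDeriv c t) +
      P (c t) (tensorDeriv (tensorDeriv c) t))

lemma IsMetricOperator.isSmoothFamily_residual (hP : IsMetricOperator P) (hA : IsDerivAdjoint P A)
    (hJ : IsOpen J) {c : ℝ → SymTensor n M} (hc : IsSmoothFamily J c)
    (hcm : ∀ t ∈ J, IsMetric (c t)) : IsSmoothFamily J (geodesicResidual P A c) := by
  have hv := hc.tensorDeriv hJ
  have hS := (((hP.isSmooth_gradHForm hA) ℝ J hJ c _ _ hcm hc hv hv).smul hJ
    (contDiffOn_const (c := (1 / 2 : ℝ)))).add hJ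
    ((((hP.isSmooth_gradKForm) ℝ J hJ c _ _ hcm hc hv hv).add hJ
      (hP.family hJ hcm hc (hv.tensorDeriv hJ))).smul hJ (contDiffOn_const (c := (-1 : ℝ))))
  refine hS.congr fun t _ => ?_
  rw [geodesicResidual]
  module

/-- The integration by parts in time behind the first variation formula. -/
lemma IsMetricOperator.hasDerivAt_momentum (hP : IsMetricOperator P) (hA : IsDerivAdjoint P A)
    (hJ : IsOpen J) {c η : ℝ → SymTensor n M} (hc : IsSmoothFamily J c)
    (hcm : ∀ t ∈ J, IsMetric (c t)) (hη : IsSmoothFamily J η) {t : ℝ} (ht : t ∈ J) :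
    HasDerivAt (fun t => GP P (c t) (tensorDeriv c t) (η t))
      (1 / 2 * tensorL2 (c t) (gradKForm P (c t) (tensorDeriv c t) (η t)) (tensorDeriv c t) +
        tensorL2 (c t) (P (c t) (tensorDeriv c t)) (tensorDeriv η t) -
        tensorL2 (c t) (η t) (geodesicResidual P A c t)) t := by
  have hv := hc.tensorDeriv hJ
  have hg := hcm t ht
  refine (hP.hasDerivAt_GP hJ hcm hc hv hη ht).congr_deriv ?_
  have e1 : derivP P (c t) (tensorDeriv c t) (tensorDeriv c t) +
      P (c t) (tensorDeriv (tensorDeriv c) t) + metricVar (c t) (tensorDeriv c t)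
        (P (c t) (tensorDeriv c t)) = (1 / 2 : ℝ) • gradHForm P A (c t) (tensorDeriv c t)
          (tensorDeriv c t) - geodesicResidual P A c t := by
    rw [geodesicResidual, gradKForm]
    module
  rw [e1, hA.tensorL2_gradKForm hg, tensorL2_sub_left hg, tensorL2_smul_left hg,
    tensorL2_comm _ (gradHForm _ _ _ _ _), tensorL2_comm _ (geodesicResidual _ _ _ _)]
  ring

variable {w : ℝ → ℝ → SymTensor n M}

/-- The integrand of the derivative of the energy of a variation `w`; the parameter of the variation
is the first coordinate and the time the second. -/
def energyVar (P : SymTensor n M → SymTensor n M →ₗ[ℝ] SymTensor n M) (w : ℝ × ℝ → SymTensor n M)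
    (q : ℝ × ℝ) : ℝ :=
  1 / 2 * tensorL2 (w q) (gradKForm P (w q) (dirDeriv w q (0, 1)) (dirDeriv w q (1, 0)))
      (dirDeriv w q (0, 1)) +
    tensorL2 (w q) (P (w q) (dirDeriv w q (0, 1)))
      (dirDeriv (fun q => dirDeriv w q (0, 1)) q (1, 0))

lemma IsMetricOperator.continuousOn_energyVar (hP : IsMetricOperator P) {U : Set (ℝ × ℝ)}
    (hU : IsOpen U) {w : ℝ × ℝ → SymTensor n M} (hw : IsSmoothFamily U w)
    (hwm : ∀ q ∈ U, IsMetric (w q)) : ContinuousOn (energyVar P w) U := by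
  have h1 := hw.dirDeriv hU (0, 1)
  have h2 := hw.dirDeriv hU (1, 0)
  exact (continuousOn_const.mul (continuousOn_tensorL2 hU hwm hw
    (hP.isSmooth_gradKForm (ℝ × ℝ) U hU _ _ _ hwm hw h1 h2) h1)).add
    (continuousOn_tensorL2 hU hwm hw (hP.family hU hwm hw h1) (h1.dirDeriv hU (1, 0)))

/-- The integrand of the energy has the derivative `2 energyVar`, because `P` is symmetric; the
factor `2` is compensated by the factor `½` in the energy. -/
lemma IsMetricOperator.hasDerivAt_energyDensity (hP : IsMetricOperator P) (hI : IsOpen I)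
    (hJ : IsOpen J) {w : ℝ × ℝ → SymTensor n M} (hw : IsSmoothFamily (I ×ˢ J) w)
    (hwm : ∀ q ∈ I ×ˢ J, IsMetric (w q)) {s t : ℝ} (hs : s ∈ I) (ht : t ∈ J) :
    HasDerivAt (fun s => GP P (w (s, t)) (dirDeriv w (s, t) (0, 1)) (dirDeriv w (s, t) (0, 1)))
      (2 * energyVar P w (s, t)) s := by
  have h1 := hw.dirDeriv (hI.prod hJ) (0, 1)
  have hm : IsMetric (w (s, t)) := hwm _ ⟨hs, ht⟩
  refine (hP.hasDerivAt_GP hI (fun s hs => hwm (s, t) ⟨hs, ht⟩) (isSmoothFamily_fst hw ht)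
    (isSmoothFamily_fst h1 ht) (isSmoothFamily_fst h1 ht) hs).congr_deriv ?_
  rw [(hasTensorDerivAt_fst hI hJ hw hs ht).tensorDeriv_eq,
    (hasTensorDerivAt_fst hI hJ h1 hs ht).tensorDeriv_eq, add_right_comm, tensorL2_add_left hm,
    hP.symm _ hm, tensorL2_comm _ _ (P _ _), energyVar, gradKForm]
  ring

lemma IsMetricOperator.hasDerivAt_energy (hP : IsMetricOperator P) (hI : IsOpen I)
    (hJ : IsOpen J) (hw : IsSmoothFamily (I ×ˢ J) (fun q : ℝ × ℝ => w q.1 q.2))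
    (hwm : ∀ s ∈ I, ∀ t ∈ J, IsMetric (w s t)) {a b : ℝ} (hab : a ≤ b) (hJab : Icc a b ⊆ J)
    {s : ℝ} (hs : s ∈ I) :
    HasDerivAt (fun s => energy P a b (w s))
      (∫ t in a..b, energyVar P (fun q : ℝ × ℝ => w q.1 q.2) (s, t)) s := by
  set w' : ℝ × ℝ → SymTensor n M := fun q => w q.1 q.2
  have hwm' : ∀ q ∈ I ×ˢ J, IsMetric (w' q) := fun q hq => hwm _ hq.1 _ hq.2
  have hsub : I ×ˢ Icc a b ⊆ I ×ˢ J := prod_mono le_rfl hJab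
  have h1 := hw.dirDeriv (hI.prod hJ) (0, 1)
  have hE := (continuousOn_tensorL2 (hI.prod hJ) hwm' hw (hP.family (hI.prod hJ) hwm' hw h1)
    h1).mono hsub
  have hE' := (continuousOn_const (c := (2 : ℝ))).mul
    ((hP.continuousOn_energyVar (hI.prod hJ) hw hwm').mono hsub)
  have hD := (hasDerivAt_setIntegral_of_compact (μ := MeasureTheory.volume) isCompact_Icc hI
    (f := fun s t => GP P (w' (s, t)) (dirDeriv w' (s, t) (0, 1)) (dirDeriv w' (s, t) (0, 1)))
    (f' := fun s t => 2 * energyVar P w' (s, t)) hE hE'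
    (fun s hs t ht => hP.hasDerivAt_energyDensity hI hJ hw hwm' hs (hJab ht)) hs).const_mul
      (1 / 2 : ℝ)
  rw [MeasureTheory.integral_const_mul, ← mul_assoc, MeasureTheory.integral_Icc_eq_integral_Ioc,
    ← intervalIntegral.integral_of_le hab] at hD
  norm_num only [one_mul] at hD
  refine hD.congr_of_eventuallyEq ?_
  filter_upwards [hI.mem_nhds hs] with s hs
  rw [energy, intervalIntegral.integral_of_le hab, ← MeasureTheory.integral_Icc_eq_integral_Ioc]
  norm_num only
  congr 1
  refine MeasureTheory.setIntegral_congr_fun measurableSet_Icc fun t ht => ?_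
  have := (hasTensorDerivAt_snd hI hJ hw hs (hJab ht)).tensorDeriv_eq
  simp only [w'] at this ⊢
  rw [this]

/-- The first variation formula for variations with fixed end points. -/
lemma IsMetricOperator.hasDerivAt_energy_zero (hP : IsMetricOperator P) (hA : IsDerivAdjoint P A)
    (hI : IsOpen I) (h0 : 0 ∈ I) (hJ : IsOpen J) {c : ℝ → SymTensor n M}
    (hw : IsSmoothFamily (I ×ˢ J) (fun q : ℝ × ℝ => w q.1 q.2))
    (hwm : ∀ s ∈ I, ∀ t ∈ J, IsMetric (w s t)) {a b : ℝ} (hab : a < b) (hJab : Icc a b ⊆ J)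
    (hc : ∀ t ∈ J, w 0 t = c t) (hwab : ∀ s ∈ I, w s a = c a ∧ w s b = c b) :
    HasDerivAt (fun s => energy P a b (w s))
      (∫ t in a..b, tensorL2 (c t) (dirDeriv (fun q : ℝ × ℝ => w q.1 q.2) (0, t) (1, 0))
        (geodesicResidual P A c t)) 0 := by
  refine (hP.hasDerivAt_energy hI hJ hw hwm hab.le hJab h0).congr_deriv ?_
  set w' : ℝ × ℝ → SymTensor n M := fun q => w q.1 q.2
  set η : ℝ → SymTensor n M := fun t => dirDeriv w' (0, t) (1, 0)
  have hcs : IsSmoothFamily J c := (isSmoothFamily_snd hw h0).congr fun t ht => (hc t ht).symm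
  have hcm : ∀ t ∈ J, IsMetric (c t) := fun t ht => hc t ht ▸ hwm 0 h0 t ht
  have hw1 := hw.dirDeriv (hI.prod hJ) (1, 0)
  have hη : IsSmoothFamily J η := isSmoothFamily_snd hw1 h0
  have hS := hP.isSmoothFamily_residual hA hJ hcs hcm
  have huIcc : uIcc a b ⊆ J := by rwa [uIcc_of_le hab.le]
  have hv : ∀ t ∈ J, dirDeriv w' (0, t) (0, 1) = tensorDeriv c t := fun t ht =>
    (hasTensorDerivAt_congr (hasTensorDerivAt_snd hI hJ hw h0 ht)
      ((hJ.mem_nhds ht |> Filter.eventually_of_mem) fun τ hτ => (hc τ hτ).symm)).tensorDeriv_eq.symm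
  have hη' : ∀ t ∈ J, dirDeriv (fun q => dirDeriv w' q (0, 1)) (0, t) (1, 0) = tensorDeriv η t :=
    fun t ht => (dirDeriv_comm (hI.prod hJ) hw ⟨h0, ht⟩ _ _).trans
      (hasTensorDerivAt_snd hI hJ hw1 h0 ht).tensorDeriv_eq.symm
  have hη0 : ∀ t ∈ J, (∀ s ∈ I, w s t = c t) → η t = 0 := fun t ht hst =>
    (hasTensorDerivAt_fst hI hJ hw h0 ht).unique (hasTensorDerivAt_congr
      (c := fun _ => c t) (fun x X Y => hasDerivAt_const _ _)
      ((hI.mem_nhds h0 |> Filter.eventually_of_mem) hst))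
  have hva : ∀ t ∈ J, energyVar P w' (0, t) = 1 / 2 * tensorL2 (c t)
      (gradKForm P (c t) (tensorDeriv c t) (η t)) (tensorDeriv c t) +
      tensorL2 (c t) (P (c t) (tensorDeriv c t)) (tensorDeriv η t) := by
    intro t ht
    have hwc : w' (0, t) = c t := hc t ht
    rw [energyVar, hv t ht, hη' t ht, hwc]
  have hcont : ContinuousOn (fun t => tensorL2 (c t) (η t) (geodesicResidual P A c t))
      (uIcc a b) := (continuousOn_tensorL2 hJ hcm hcs hη hS).mono huIcc
  have hcont' : ContinuousOn (fun t => energyVar P w' (0, t)) (uIcc a b) :=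
    (hP.continuousOn_energyVar (hI.prod hJ) hw fun q hq => hwm _ hq.1 _ hq.2).comp
      (by fun_prop) fun t ht => ⟨h0, huIcc ht⟩
  have hFTC := intervalIntegral.integral_eq_sub_of_hasDerivAt (a := a) (b := b)
    (f := fun t => GP P (c t) (tensorDeriv c t) (η t))
    (f' := fun t => energyVar P w' (0, t) - tensorL2 (c t) (η t) (geodesicResidual P A c t))
    (fun t ht => by
      rw [hva t (huIcc ht)]
      exact hP.hasDerivAt_momentum hA hJ hcs hcm hη (huIcc ht))
    (hcont'.sub hcont).intervalIntegrable
  have ha : a ∈ J := hJab ⟨le_rfl, hab.le⟩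
  have hb : b ∈ J := hJab ⟨hab.le, le_rfl⟩
  have hz : ∀ t ∈ J, ∀ h : SymTensor n M, GP P (c t) h 0 = 0 := fun t ht h => by
    rw [GP, hP.symm _ (hcm t ht), map_zero, tensorL2_comm]
    simpa using tensorL2_smul_left (hcm t ht) 0 h 0
  simp only [hη0 a ha fun s hs => (hwab s hs).1, hη0 b hb fun s hs => (hwab s hs).2, hz a ha,
    hz b hb, sub_zero] at hFTC
  rw [intervalIntegral.integral_sub hcont'.intervalIntegrable hcont.intervalIntegrable] at hFTC
  exact sub_eq_zero.1 hFTC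

/-- The variations `c + s χ e` with a bump function `χ` in time and `P e` equal to the residual at
one time show that the residual of a geodesic vanishes. -/
lemma IsMetricOperator.residual_eq_zero (hP : IsMetricOperator P) (hA : IsDerivAdjoint P A)
    (hJ : IsOpen J) {c : ℝ → SymTensor n M} (hc : IsSmoothFamily J c)
    (hcm : ∀ t ∈ J, IsMetric (c t)) (hg : IsGeodesicOn P J c) {t₀ : ℝ} (ht₀ : t₀ ∈ J) :
    geodesicResidual P A c t₀ = 0 := by
  by_contra hne
  obtain ⟨e, he⟩ := (hP.bij _ (hcm t₀ ht₀)).2 (geodesicResidual P A c t₀)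
  have he0 : e ≠ 0 := by
    rintro rfl
    exact hne (he ▸ map_zero _)
  have hφ : ContinuousOn (fun t => tensorL2 (c t) e (geodesicResidual P A c t)) J :=
    continuousOn_tensorL2 hJ hcm hc (isSmoothFamily_const J e)
      (hP.isSmoothFamily_residual hA hJ hc hcm)
  have hφ0 : 0 < tensorL2 (c t₀) e (geodesicResidual P A c t₀) := by
    rw [← he, tensorL2_comm]
    exact hP.pos _ (hcm t₀ ht₀) e he0
  obtain ⟨δ, hδ, hball⟩ := Metric.nhds_basis_closedBall.mem_iff.1 (Filter.inter_mem
    (hJ.mem_nhds ht₀) ((hφ.continuousAt (hJ.mem_nhds ht₀)).eventually_const_lt hφ0))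
  rw [Real.closedBall_eq_Icc] at hball
  have hab : t₀ - δ < t₀ + δ := by linarith
  have hJab : Icc (t₀ - δ) (t₀ + δ) ⊆ J := fun t ht => (hball ht).1
  let χ : ContDiffBump t₀ := ⟨δ / 2, δ, by positivity, by linarith⟩
  have hχ0 : ∀ t, t ∉ Ioo (t₀ - δ) (t₀ + δ) → χ t = 0 := fun t ht => by
    rw [← Real.ball_eq_Ioo] at ht
    exact χ.zero_of_le_dist (by simpa using ht)
  have hχ1 : ∀ t ∈ Ioo (t₀ - δ) (t₀ + δ), 0 < χ t := fun t ht => by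
    rw [← Real.ball_eq_Ioo] at ht
    exact χ.pos_of_mem_ball ht
  let w : ℝ → ℝ → SymTensor n M := fun s t => c t + (s * χ t) • e
  have hoJ : IsOpen ((univ : Set ℝ) ×ˢ J) := isOpen_univ.prod hJ
  have hw : IsSmoothFamily ((univ : Set ℝ) ×ˢ J) (fun q : ℝ × ℝ => w q.1 q.2) :=
    (hc.comp contDiff_snd.contDiffOn fun q hq => hq.2).add hoJ
      ((isSmoothFamily_const _ e).smul hoJ
        (contDiff_fst.mul (χ.contDiff.comp contDiff_snd)).contDiffOn)
  have hw0 : ∀ t, w 0 t = c t := fun t => by simp [w]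
  have hwout : ∀ s t, t ∉ Ioo (t₀ - δ) (t₀ + δ) → w s t = c t := fun s t ht => by
    simp [w, hχ0 t ht]
  -- Positivity is an open condition, uniformly over the compact support of `χ`.
  have hev : ∀ᶠ s in 𝓝 (0 : ℝ), ∀ t ∈ Icc (t₀ - δ) (t₀ + δ), IsMetric (w s t) :=
    isCompact_Icc.eventually_forall_of_forall_eventually fun t ht =>
      hw.eventually_isMetric hoJ (u := (0, t)) ⟨mem_univ _, hJab ht⟩
        (by simpa only [hw0] using hcm t (hJab ht))
  obtain ⟨ε, hε, hεw⟩ := Metric.eventually_nhds_iff_ball.1 hev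
  rw [Real.ball_eq_Ioo, zero_sub, zero_add] at hεw
  have hwm : ∀ s ∈ Ioo (-ε) ε, ∀ t ∈ J, IsMetric (w s t) := by
    intro s hs t ht
    by_cases h : t ∈ Icc (t₀ - δ) (t₀ + δ)
    · exact hεw s hs t h
    · rw [hwout s t fun h' => h (Ioo_subset_Icc_self h')]
      exact hcm t ht
  have hI0 : (0 : ℝ) ∈ Ioo (-ε) ε := ⟨by linarith, hε⟩
  have hw' := hw.mono (U' := Ioo (-ε) ε ×ˢ J) (prod_mono (subset_univ _) le_rfl)
  have hends : ∀ s ∈ Ioo (-ε) ε, w s (t₀ - δ) = c (t₀ - δ) ∧ w s (t₀ + δ) = c (t₀ + δ) :=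
    fun s _ => ⟨hwout s _ fun h => lt_irrefl _ h.1, hwout s _ fun h => lt_irrefl _ h.2⟩
  have hint := (hg _ _ hab hJab ε hε w hw' hwm (fun t _ => hw0 t) hends).unique
    (hP.hasDerivAt_energy_zero hA isOpen_Ioo hI0 hJ hw' hwm hab hJab (fun t _ => hw0 t) hends)
  have hws : ∀ t ∈ J, dirDeriv (fun q : ℝ × ℝ => w q.1 q.2) (0, t) (1, 0) = χ t • e :=
    fun t ht => (hasTensorDerivAt_fst isOpen_Ioo hJ hw' hI0 ht).unique fun x X Y => by
      have := (((hasDerivAt_id (0 : ℝ)).mul_const (χ t)).mul_const (e x X Y)).const_add (c t x X Y)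
      rw [one_mul] at this
      exact this
  have hcongr : ∀ t ∈ Icc (t₀ - δ) (t₀ + δ), tensorL2 (c t)
      (dirDeriv (fun q : ℝ × ℝ => w q.1 q.2) (0, t) (1, 0)) (geodesicResidual P A c t) =
      χ t * tensorL2 (c t) e (geodesicResidual P A c t) := fun t ht => by
    rw [hws t (hJab ht), tensorL2_smul_left (hcm t (hJab ht))]
  rw [intervalIntegral.integral_congr (g := fun t => χ t *
    tensorL2 (c t) e (geodesicResidual P A c t)) (by rwa [uIcc_of_le hab.le])] at hint
  refine (intervalIntegral.intervalIntegral_pos_of_pos_on ?_ (fun t ht => mul_pos (hχ1 t ht)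
    (hball (Ioo_subset_Icc_self ht)).2) hab).ne hint
  refine ContinuousOn.intervalIntegrable ?_
  rw [uIcc_of_le hab.le]
  exact χ.continuous.continuousOn.mul (hφ.mono hJab)

/-- The geodesics are the curves of metrics for which the residual vanishes. -/
lemma IsMetricOperator.isGeodesicOn_iff (hP : IsMetricOperator P) (hA : IsDerivAdjoint P A)
    (hJ : IsOpen J) {c : ℝ → SymTensor n M} (hc : IsSmoothFamily J c)
    (hcm : ∀ t ∈ J, IsMetric (c t)) :
    IsGeodesicOn P J c ↔ ∀ t ∈ J, geodesicResidual P A c t = 0 := by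
  refine ⟨fun hg t ht => hP.residual_eq_zero hA hJ hc hcm hg ht, ?_⟩
  intro hS a b hab hJab ε hε w hw hwm hw0 hwab
  refine (hP.hasDerivAt_energy_zero hA isOpen_Ioo ⟨by linarith, hε⟩ hJ hw hwm hab hJab hw0
    hwab).congr_deriv ?_
  rw [intervalIntegral.integral_congr (g := fun _ => (0 : ℝ)), intervalIntegral.integral_zero]
  intro t ht
  rw [uIcc_of_le hab.le] at ht
  have hm := hcm t (hJab ht)
  simp only [hS t (hJab ht)]
  rw [tensorL2_comm]
  simpa using tensorL2_smul_left hm 0 _ 0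

end Geodesics

end MetricSpaceOfMetrics

end

open MetricSpaceOfMetrics in
theorem mainTheorem2 {n : ℕ} {M : Type*} [TopologicalSpace M]
    [ChartedSpace (EuclideanSpace ℝ (Fin n)) M] [IsManifold (𝓡 n) ∞ M] [T2Space M] [CompactSpace M]
    (P : SymTensor n M → SymTensor n M →ₗ[ℝ] SymTensor n M) (hP : IsMetricOperator P) :
    -- the derivative of `P` exists
    (∀ g, IsMetric g → ∀ m h,
      HasTensorDerivAt (fun s => P (g + s • m) h) (derivP P g m h) 0) ∧
    -- the gradient `K` exists, is bilinear, and is given by the formula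
    (∃ K, IsGradientK P K ∧ IsBilinear K) ∧
    (∀ K, IsGradientK P K ↔ ∀ g, IsMetric g → ∀ h m, ∀ x : M,
      P g (K g h m) x =
        -sandwich (g x) (m x) (P g h x) + derivP P g m h x
          - sandwich (g x) (P g h x) (m x)
          + (1 / 2 * traceForm (g x) (m x)) • P g h x) ∧
    -- if the inverse of `P` is smooth, then `K` is smooth
    (∀ Q : SymTensor n M → SymTensor n M → SymTensor n M,
      (∀ g, IsMetric g → ∀ h, P g (Q g h) = h) → IsSmooth₂ Q →
        ∀ K, IsGradientK P K → IsSmooth₃ K) ∧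
    ∀ A, IsDerivAdjoint P A →
      -- the gradient `H` exists, is bilinear, and is given by the formula
      (∃ H, IsGradientH P H ∧ IsBilinear H) ∧
      (∀ H, IsGradientH P H ↔ ∀ g, IsMetric g → ∀ h k, ∀ x : M,
        P g (H g h k) x =
          A g h k x - sandwich (g x) (P g h x) (k x)
            - sandwich (g x) (k x) (P g h x)
            + (1 / 2 * g02 (g x) (P g h x) (k x)) • g x) ∧
      -- if the inverse of `P` is smooth, then `H` is smooth
      (∀ Q : SymTensor n M → SymTensor n M → SymTensor n M,
        (∀ g, IsMetric g → ∀ h, P g (Q g h) = h) → IsSmooth₂ Q →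
          ∀ H, IsGradientH P H → IsSmooth₃ H) ∧
      -- the geodesic equation
      ∀ (J : Set ℝ) (c v a : ℝ → SymTensor n M), IsOpen J → IsSmoothFamily J c →
        (∀ t ∈ J, IsMetric (c t)) → v = tensorDeriv c → a = tensorDeriv v →
        (∀ t ∈ J, HasTensorDerivAt c (v t) t ∧ HasTensorDerivAt v (a t) t ∧
          HasTensorDerivAt (fun τ => P (c τ) (v τ))
            (derivP P (c t) (v t) (v t) + P (c t) (a t)) t) ∧
        List.TFAE [
          IsGeodesicOn P J c,
          ∀ K H, IsGradientK P K → IsGradientH P H → ∀ t ∈ J,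
            a t = (1 / 2 : ℝ) • H (c t) (v t) (v t) - K (c t) (v t) (v t),
          ∀ t ∈ J, ∀ x : M,
            P (c t) (a t) x =
              (1 / 2 : ℝ) • A (c t) (v t) (v t) x
                + (1 / 4 * g02 (c t x) (P (c t) (v t) x) (v t x)) • c t x
                + (1 / 2 : ℝ) • sandwich (c t x) (v t x) (P (c t) (v t) x)
                + (1 / 2 : ℝ) • sandwich (c t x) (P (c t) (v t) x) (v t x)
                - derivP P (c t) (v t) (v t) x
                - (1 / 2 * traceForm (c t x) (v t x)) • P (c t) (v t) x,
          ∀ t ∈ J, ∀ x : M,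
            tensorDeriv (fun τ => P (c τ) (v τ)) t x =
              (1 / 2 : ℝ) • A (c t) (v t) (v t) x
                + (1 / 4 * g02 (c t x) (P (c t) (v t) x) (v t x)) • c t x
                + (1 / 2 : ℝ) • sandwich (c t x) (v t x) (P (c t) (v t) x)
                + (1 / 2 : ℝ) • sandwich (c t x) (P (c t) (v t) x) (v t x)
                - (1 / 2 * traceForm (c t x) (v t x)) • P (c t) (v t) x] := by
  refine ⟨fun g hg m h => hP.hasTensorDerivAt_derivP hg m h, ?_, fun K => ?_, ?_, ?_⟩
  · obtain ⟨K, hK, hb⟩ := hP.exists_bilinear hP.isBilinear_gradKForm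
    exact ⟨K, (hP.isGradientK_iff K).2 hK, hb⟩
  · rw [hP.isGradientK_iff]
    refine forall₄_congr fun g hg h m => ?_
    simp only [← gradKForm_apply hg]
    exact ⟨fun h x => by rw [h], SymTensor.ext⟩
  · intro Q hQ hQs K hK
    exact hP.isSmooth_of_inverse hQ hQs hP.isSmooth_gradKForm ((hP.isGradientK_iff K).1 hK)
  intro A hA
  refine ⟨?_, fun H => ?_, ?_, ?_⟩
  · obtain ⟨H, hH, hb⟩ := hP.exists_bilinear hA.isBilinear_gradHForm
    exact ⟨H, (hP.isGradientH_iff hA H).2 hH, hb⟩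
  · rw [hP.isGradientH_iff hA]
    refine forall₄_congr fun g hg h k => ?_
    simp only [← gradHForm_apply hg]
    exact ⟨fun h x => by rw [h], SymTensor.ext⟩
  · intro Q hQ hQs H hH
    exact hP.isSmooth_of_inverse hQ hQs (hP.isSmooth_gradHForm hA) ((hP.isGradientH_iff hA H).1 hH)
  rintro J c v a hJ hc hcm rfl rfl
  have hv := hc.tensorDeriv hJ
  have hPv : ∀ t ∈ J, HasTensorDerivAt (fun τ => P (c τ) (tensorDeriv c τ))
      (derivP P (c t) (tensorDeriv c t) (tensorDeriv c t) +
        P (c t) (tensorDeriv (tensorDeriv c) t)) t :=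
    fun t ht => hP.hasTensorDerivAt_comp hJ hcm hc hv ht
  refine ⟨fun t ht => ⟨hc.hasTensorDerivAt hJ ht, hv.hasTensorDerivAt hJ ht, hPv t ht⟩, ?_⟩
  tfae_have 1 ↔ 3 := by
    rw [hP.isGeodesicOn_iff hA hJ hc hcm]
    refine forall₂_congr fun t ht => ?_
    have hx : ∀ x : M, geodesicResidual P A c t x =
        (1 / 2 : ℝ) • gradHForm P A (c t) (tensorDeriv c t) (tensorDeriv c t) x -
          (gradKForm P (c t) (tensorDeriv c t) (tensorDeriv c t) x +
            P (c t) (tensorDeriv (tensorDeriv c) t) x) := fun x => by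
      rw [geodesicResidual, SymTensor.sub_apply, SymTensor.smul_apply, SymTensor.add_apply]
    have h0 : geodesicResidual P A c t = 0 ↔ ∀ x : M, geodesicResidual P A c t x = 0 :=
      ⟨fun h x => by rw [h, SymTensor.zero_apply],
        fun h => SymTensor.ext fun x => by rw [h x, SymTensor.zero_apply]⟩
    rw [h0]
    refine forall_congr' fun x => ?_
    rw [hx, gradHForm_apply (hcm t ht), gradKForm_apply (hcm t ht), eq_comm, ← sub_eq_zero,
      ← sub_eq_zero (a := P (c t) (tensorDeriv (tensorDeriv c) t) x)]
    refine Eq.congr ?_ rfl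
    module
  tfae_have 1 ↔ 2 := by
    rw [hP.isGeodesicOn_iff hA hJ hc hcm]
    have key : ∀ K H, IsGradientK P K → IsGradientH P H → ∀ t ∈ J,
        (geodesicResidual P A c t = 0 ↔ tensorDeriv (tensorDeriv c) t =
          (1 / 2 : ℝ) • H (c t) (tensorDeriv c t) (tensorDeriv c t) -
            K (c t) (tensorDeriv c t) (tensorDeriv c t)) := by
      intro K H hK hH t ht
      rw [geodesicResidual, ← (hP.isGradientH_iff hA H).1 hH _ (hcm t ht),
        ← (hP.isGradientK_iff K).1 hK _ (hcm t ht), ← map_smul, ← map_add, ← map_sub,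
        (hP.bij _ (hcm t ht)).1.eq_iff' (map_zero _), ← sub_sub, sub_eq_zero, eq_comm]
    refine ⟨fun h K H hK hH t ht => (key K H hK hH t ht).1 (h t ht), fun h t ht => ?_⟩
    obtain ⟨K, hK, -⟩ := hP.exists_bilinear hP.isBilinear_gradKForm
    obtain ⟨H, hH, -⟩ := hP.exists_bilinear hA.isBilinear_gradHForm
    have hK' := (hP.isGradientK_iff K).2 hK
    have hH' := (hP.isGradientH_iff hA H).2 hH
    exact (key K H hK' hH' t ht).2 (h K H hK' hH' t ht)
  tfae_have 3 ↔ 4 := by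
    refine forall₃_congr fun t ht x => ?_
    rw [(hPv t ht).tensorDeriv_eq, SymTensor.add_apply]
    constructor <;> intro h
    · rw [h]; module
    · rw [← sub_eq_zero] at h ⊢
      rw [← h]; module
  tfae_finish
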